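/- Let $n,d\ge 1$ and let $c_0,\dots,c_n\in\mathbb R[\gamma]$ be polynomials of degree at most $d$, not all identically zero, given by their coefficients. Put $p_\gamma(x)=\sum_{k=0}^n c_k(\gamma)x^k$ and let $m$ be the largest index with $c_m\not\equiv 0$. For a real polynomial $p=a_N\prod_{i=1}^N(x-x_i)$ of degree $N$ (with $x_i\in\mathbb C$) and $k\ge1$, the $k$-th subdiscriminant is $$\mathrm{sDisc}_k(p)=a_N^{2k-2}\sum_{S\subset\{1,\dots,N\},\,|S|=k}\ \prod_{\{i,j\}\subset S}(x_i-x_j)^2 ,$$ so that $\mathrm{sDisc}_k(p)=0$ for $k>N$. For $0\le k<N$ the $k$-th subresultant $\mathrm{sRes}_k(p,p')$ is the determinant of the first $2N-1-2k$ columns of the $(2N-1-2k)\times(2N-1-k)$ matrix whose first $N-1-k$ rows are the coefficient row $(a_N,\dots,a_0)$ of $p$ shifted to the right by $0,1,\dots,N-2-k$ places, and whose last $N-k$ rows are the coefficient row $(Na_N,\dots,a_1)$ of $p'$ shifted to the right by $N-1-k,\dots,1,0$ places. Algorithm FastRR works as follows, in exact real arithmetic. 1. Determine $m$, and find $2dn$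 distinct points $\gamma_1,\dots,\gamma_{2dn}\in\mathbb R$ with $c_m(\gamma_i)\ne0$ by testing the $2dn+d$ candidates $0,1,\dots,2dn+d-1$. 2. For each $i$ compute the coefficients of $p_{\gamma_i}$ and all the subresultants $\mathrm{sRes}_k(p_{\gamma_i},p_{\gamma_i}')$, $0\le k<m$, by a subresultant algorithm with a quadratic number of operations (the signed Euclidean algorithm). 3. For each $i$ compute the values $c_m(\gamma_i)^{-1}\,\mathrm{sRes}_{m-k}(p_{\gamma_i},p_{\gamma_i}')$ for $1\le k\le m$, and $0$ for $m<k\le n$. 4. For each $k=1,\dots,n$ let $q_k\in\mathbb R[\gamma]$ be the polynomial of degree less than $2dn$ that takes these values at $\gamma_1,\dots,\gamma_{2dn}$, and compute its coefficients by fast interpolation (divide-and-conquer Lagrange interpolation with Toom–Cook multiplication). Output $q_1,\dots,q_n$. **Theorem.** FastRR is correct: it never divides by zero; its points $\gamma_i$ are $2dn$ distinct real numbers with $c_m(\gamma_i)\neq 0$; in step 2 it computes all $\mathrm{sRes}_k(p_{\gamma_i},p_{\gamma_i}')$, $0\le k<m$; and its output consists of $n$ polynomials $q_1,\dots,q_n$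 of degree at most $2dn$ such that $q_k(\gamma)=\mathrm{sDisc}_k(p_\gamma)$ for every $k=1,\dots,n$ and every $\gamma\in\mathbb R$ with $c_m(\gamma)\ne0$. Moreover, FastRR runs in $O(n^4)$ time for $d=O(n)$: for every $\kappa$ there is a constant $A$, depending only on $\kappa$, such that whenever $d\le\kappa n$ the number of steps (arithmetic operations, loads of integer constants, and tests whether a number is zero) is at most $A\,n^4$. -/

import Mathlib

open Polynomial

/-! ## The polynomials: subdiscriminants and subresultants -/

/-- The `k`-th subdiscriminant `aₙ ^ (2k - 2) * ∑_{|S| = k} ∏_{{i,j} ⊆ S} (xᵢ - xⱼ)²` of a real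
polynomial with leading coefficient `aₙ` and complex roots `x₁, …, xₙ`, listed with multiplicity. -/
noncomputable def sDisc (k : ℕ) (p : ℝ[X]) : ℂ :=
  let x : List ℂ := (p.map (algebraMap ℝ ℂ)).roots.toList
  ((p.leadingCoeff : ℝ) : ℂ) ^ (2 * (k : ℤ) - 2) *
    ∑ S ∈ (Finset.univ : Finset (Fin x.length)).powersetCard k,
      ∏ i ∈ S, ∏ j ∈ S with i < j, (x.get i - x.get j) ^ 2

/-- The `j`-th entry of the row `0, …, 0, f_e, f_(e-1), …, f_0, 0, …, 0` with `s` leading zeros,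
where `f_i` is the coefficient of `X ^ i` in `f`. -/
noncomputable def shiftedRow (f : ℝ[X]) (e s j : ℕ) : ℝ :=
  if s ≤ j ∧ j ≤ e + s then f.coeff (e + s - j) else 0

/-- The `k`-th subresultant `sRes_k(p, p')` of a polynomial `p` of degree `n > k`: the determinant of
the first `2n - 1 - 2k` columns of the matrix whose first `n - 1 - k` rows are the coefficients of
`p` shifted by `0, 1, …, n - 2 - k`, and whose last `n - k` rows are the coefficients of `p'` shifted
by `n - 1 - k, …, 1, 0`. -/
noncomputable def sRes (k : ℕ) (p : ℝ[X]) : ℝ :=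
  let n := p.natDegree
  Matrix.det (Matrix.of fun i j : Fin (2 * n - 1 - 2 * k) =>
    if (i : ℕ) < n - 1 - k then shiftedRow p n i j
    else shiftedRow (derivative p) (n - 1) (2 * n - 2 - 2 * k - i) j)

/-- The member `p_γ(x) = ∑ₖ cₖ(γ) xᵏ` of the family with coefficients `c₀, …, cₙ ∈ ℝ[γ]`. -/
noncomputable def member {n : ℕ} (c : Fin (n + 1) → ℝ[X]) (γ : ℝ) : ℝ[X] :=
  ∑ k : Fin (n + 1), C ((c k).eval γ) * X ^ (k : ℕ)

/-- The polynomial with the given list of coefficients, constant coefficient first. -/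
noncomputable def ofCoeffs : List ℝ → ℝ[X]
  | [] => 0
  | a :: l => C a + X * ofCoeffs l

/-! ## The model of computation: exact field arithmetic with unit cost

A program over the type `K` of numbers can load an integer constant, perform one of the four
arithmetic operations, and branch on whether a number is zero. Programs below are written uniformly
in an unspecified type `K`, so that they have no other access to the numbers. -/

inductive ArithOp : Type
  | add | sub | mul | div

inductive Prog (K α : Type) : Type
  | ret (a : α) : Prog K α
  | const (z : ℤ) (next : K → Prog K α) : Prog K α
  | arith (o : ArithOp) (x y : K) (next : K → Prog K α) : Prog K α
  | test (x : K) (next : Bool → Prog K α) : Prog K α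

namespace Prog

/-- Running a program over a field: its result and the number of its steps (constants, arithmetic
operations and tests). A division by zero makes the run fail. -/
def run {F α : Type} [Field F] [DecidableEq F] : Prog F α → Option (α × ℕ)
  | ret a => some (a, 0)
  | const z next => (run (next (z : F))).map fun r => (r.1, r.2 + 1)
  | arith .add x y next => (run (next (x + y))).map fun r => (r.1, r.2 + 1)
  | arith .sub x y next => (run (next (x - y))).map fun r => (r.1, r.2 + 1)
  | arith .mul x y next => (run (next (x * y))).map fun r => (r.1, r.2 + 1)
  | arith .div x y next =>
      if y = 0 then none else (run (next (x / y))).map fun r => (r.1, r.2 + 1)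
  | test x next => (run (next (decide (x = 0)))).map fun r => (r.1, r.2 + 1)

/-- Sequential composition. -/
def seq {K α β : Type} : Prog K α → (α → Prog K β) → Prog K β
  | ret a, f => f a
  | const z next, f => const z fun v => seq (next v) f
  | arith o x y next, f => arith o x y fun v => seq (next v) f
  | test x next, f => test x fun b => seq (next b) f

instance {K : Type} : Monad (Prog K) where
  pure := ret
  bind := seq

variable {K : Type}

def int (z : ℤ) : Prog K K := const z ret
def add (x y : K) : Prog K K := arith .add x y ret
def sub (x y : K) : Prog K K := arith .sub x y ret
def mul (x y : K) : Prog K K := arith .mul x y ret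
def div (x y : K) : Prog K K := arith .div x y ret
def isZero (x : K) : Prog K Bool := test x ret

def mapList {α β : Type} (f : α → Prog K β) : List α → Prog K (List β)
  | [] => pure []
  | a :: l => do
    let b ← f a
    let bs ← mapList f l
    pure (b :: bs)

/-! ## Elementary operations on coefficient lists -/

def pow (x : K) : ℕ → Prog K K
  | 0 => int 1
  | e + 1 => do
    let y ← pow x e
    mul x y

def zeros (l : ℕ) : Prog K (List K) := do
  let z ← int 0
  pure (List.replicate l z)

def addL : List K → List K → Prog K (List K)
  | [], bs => pure bs
  | as, [] => pure as
  | a :: as, b :: bs => do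
    let s ← add a b
    let rest ← addL as bs
    pure (s :: rest)

def scaleL (x : K) (l : List K) : Prog K (List K) := mapList (mul x) l

def negL (l : List K) : Prog K (List K) := do
  let z ← int 0
  mapList (sub z) l

def divL (l : List K) (x : K) : Prog K (List K) := mapList (fun a => div a x) l

def subL (as bs : List K) : Prog K (List K) := do
  let nbs ← negL bs
  addL as nbs

/-- `l(X) + X ^ b * h(X)`, constant coefficients first. -/
def addShift (b : ℕ) (l h : List K) : Prog K (List K) := do
  let z ← zeros b
  addL l (z ++ h)

/-- Horner evaluation, constant coefficient first. -/
def evalAt : List K → K → Prog K K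
  | [], _ => int 0
  | a :: l, x => do
    let v ← evalAt l x
    let t ← mul x v
    add a t

def allZero : List K → Prog K Bool
  | [] => pure true
  | a :: l => do
    let z ← isZero a
    if z then allZero l else pure false

/-! ## Step 1: the leading coefficient and the evaluation points -/

/-- Deletes the rows behind the last row that is not zero. -/
def trimRows : List (List K) → Prog K (List (List K))
  | [] => pure []
  | r :: rs => do
    let rs' ← trimRows rs
    if rs'.isEmpty then do
      let z ← allZero r
      pure (if z then [] else [r])
    else pure (r :: rs')

/-- Tests the candidates and keeps the points at which the polynomial `top` does not vanish,
together with its values there. -/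
def goodPoints (top : List K) : List ℕ → Prog K (List (K × K))
  | [] => pure []
  | j :: js => do
    let x ← int j
    let v ← evalAt top x
    let z ← isZero v
    let rest ← goodPoints top js
    pure (if z then rest else (x, v) :: rest)

/-! ## Step 2: all subresultants of a polynomial and its derivative in quadratic time

The signed Euclidean algorithm, on polynomials with the leading coefficient first. -/

/-- The coefficients `k a₀, (k + 1) a₁, …`. -/
def derivFrom : ℕ → List K → Prog K (List K)
  | _, [] => pure []
  | k, a :: l => do
    let c ← int k
    let t ← mul c a
    let rest ← derivFrom (k + 1) l
    pure (t :: rest)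

/-- Subtracts `x` times the second list from the front of the first. -/
def subScaled (x : K) : List K → List K → Prog K (List K)
  | as, [] => pure as
  | [], _ => pure []
  | a :: as, b :: bs => do
    let t ← mul x b
    let s ← sub a t
    let rest ← subScaled x as bs
    pure (s :: rest)

/-- Long division by `b :: bs`: `s` division steps, each of which removes the leading entry. -/
def remLoop (b : K) (bs : List K) : ℕ → List K → Prog K (List K)
  | 0, as => pure as
  | _ + 1, [] => pure []
  | s + 1, a :: as => do
    let x ← div a b
    let as' ← subScaled x as bs
    remLoop b bs s as'

def stripZeros : List K → Prog K (List K)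
  | [] => pure []
  | a :: l => do
    let z ← isZero a
    if z then stripZeros l else pure (a :: l)

/-- The list of `μ * sRes_j(A, B)` for `j = deg A - 1, …, 0`, where `deg B < deg A`. With
`p = deg A`, `q = deg B`, `b` the leading coefficient of `B`, `R` the remainder of `A` by `B`,
`r = deg R` and `ε = (-1) ^ ((p - q) (p - q - 1) / 2)` it uses
`sRes_j(A, B) = 0` for `q < j < p`, `sRes_q(A, B) = ε b ^ (p - q)` and
`sRes_j(A, B) = ε b ^ (p - r) sRes_j(B, -R)` for `j < q`.
The first argument bounds the number of divisions. -/
def sResLoop : ℕ → K → List K → List K → Prog K (List K)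
  | 0, _, A, _ => zeros (A.length - 1)
  | _ + 1, _, A, [] => zeros (A.length - 1)
  | f + 1, μ, A, b :: bs => do
    let δ := A.length - (bs.length + 1)
    let ε ← int ((-1) ^ (δ * (δ - 1) / 2))
    let ν ← mul μ ε
    let y ← pow b δ
    let s ← mul ν y
    let z ← zeros (δ - 1)
    let R₀ ← remLoop b bs (δ + 1) A
    let R₁ ← negL R₀
    let R ← stripZeros R₁
    let w ← pow b (A.length - R.length)
    let μ' ← mul ν w
    let rest ← sResLoop f μ' (b :: bs) R
    pure (z ++ s :: rest)

/-- From the coefficients of `p`, constant coefficient first and leading coefficient nonzero, the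
list of `sRes_0(p, p'), …, sRes_(m-1)(p, p')`, where `m` is the degree of `p`. -/
def allSRes (p : List K) : Prog K (List K) := do
  let p' ← derivFrom 1 p.tail
  let one ← int 1
  let l ← sResLoop p.length one p.reverse p'.reverse
  pure l.reverse

/-! ## Step 4: fast interpolation

Lagrange interpolation by divide and conquer, on top of a fast (three-way Toom-Cook)
multiplication of polynomials. Constant coefficients come first. -/

/-- The product of two polynomials with at most `3 ^ k` coefficients each, from five products of
polynomials with at most `3 ^ (k - 1)` coefficients: evaluation at `0, 1, -1, 2, ∞`. -/
def toomCook : ℕ → List K → List K → Prog K (List K)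
  | _, [], _ => pure []
  | _, _, [] => pure []
  | 0, a :: _, b :: _ => do
    let t ← mul a b
    pure [t]
  | k + 1, a :: as, b :: bs => do
    let w := 3 ^ k
    let two ← int 2
    let three ← int 3
    let four ← int 4
    let sixteen ← int 16
    let a₀ := (a :: as).take w
    let a₁ := ((a :: as).drop w).take w
    let a₂ := (a :: as).drop (2 * w)
    let b₀ := (b :: bs).take w
    let b₁ := ((b :: bs).drop w).take w
    let b₂ := (b :: bs).drop (2 * w)
    -- values at 1 and -1
    let ea ← addL a₀ a₂
    let eb ← addL b₀ b₂
    let ap ← addL ea a₁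
    let bp ← addL eb b₁
    let am ← subL ea a₁
    let bm ← subL eb b₁
    -- values at 2
    let a₁' ← scaleL two a₁
    let a₂' ← scaleL four a₂
    let b₁' ← scaleL two b₁
    let b₂' ← scaleL four b₂
    let a₁₂ ← addL a₁' a₂'
    let b₁₂ ← addL b₁' b₂'
    let at₂ ← addL a₀ a₁₂
    let bt₂ ← addL b₀ b₁₂
    -- the five products
    let c₀ ← toomCook k a₀ b₀
    let rp ← toomCook k ap bp
    let rm ← toomCook k am bm
    let rt ← toomCook k at₂ bt₂
    let c₄ ← toomCook k a₂ b₂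
    -- interpolation
    let u ← addL rp rm
    let u ← divL u two
    let u ← subL u c₀
    let c₂ ← subL u c₄
    let v ← subL rp rm
    let v ← divL v two
    let t ← subL rt c₀
    let c₂' ← scaleL four c₂
    let t ← subL t c₂'
    let c₄' ← scaleL sixteen c₄
    let t ← subL t c₄'
    let t ← divL t two
    let t ← subL t v
    let c₃ ← divL t three
    let c₁ ← subL v c₃
    let h ← addShift w c₃ c₄
    let h ← addShift w c₂ h
    let h ← addShift w c₁ h
    addShift w c₀ h

def mulPoly (as bs : List K) : Prog K (List K) := do
  let l ← toomCook (Nat.clog 3 (max as.length bs.length)) as bs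
  pure (l.take (as.length + bs.length - 1))

/-- For a list of at most `2 ^ s` pairs `(xᵢ, uᵢ)`: the polynomials `∏ᵢ (X - xᵢ)` and
`∑ᵢ uᵢ ∏_{j ≠ i} (X - xⱼ)`. -/
def combine : ℕ → List (K × K) → Prog K (List K × List K)
  | _, [] => do
    let one ← int 1
    pure ([one], [])
  | 0, a :: _ => do
    let z ← int 0
    let y ← sub z a.1
    let one ← int 1
    pure ([y, one], [a.2])
  | s + 1, a :: l => do
    let r₁ ← combine s ((a :: l).take (2 ^ s))
    let r₂ ← combine s ((a :: l).drop (2 ^ s))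
    let M ← mulPoly r₁.1 r₂.1
    let F₁ ← mulPoly r₁.2 r₂.1
    let F₂ ← mulPoly r₂.2 r₁.1
    let F ← addL F₁ F₂
    pure (M, F)

/-- The product of `x - y` over the list of the `y`. -/
def prodDiff (x : K) : List K → Prog K K
  | [] => int 1
  | y :: l => do
    let t ← sub x y
    let r ← prodDiff x l
    mul t r

/-- For each point of the second list, the product of its differences to all the other points of
both lists. -/
def nodeWeights : List K → List K → Prog K (List K)
  | _, [] => pure []
  | pre, x :: post => do
    let w ← prodDiff x (pre ++ post)
    let ws ← nodeWeights (pre ++ [x]) post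
    pure (w :: ws)

/-- The interpolating polynomial for the values `vs` at the points `xs` with weights `ws`. -/
def interpolate (xs ws vs : List K) : Prog K (List K) := do
  let us ← mapList (fun a => div a.1 a.2) (vs.zip ws)
  let r ← combine (Nat.clog 2 xs.length) (xs.zip us)
  pure r.2

end Prog

/-! ## The algorithm FastRR -/

/-- What a run of the algorithm produces: the points `γᵢ`, for each of them the list of the
subresultants of `p_γᵢ`, and the coefficient lists of the output polynomials `q₁, …, qₙ`. -/
structure FastRRData (K : Type) where
  points : List K
  sres : List (List K)
  output : List (List K)

/-- The input is the matrix of the coefficients of `c₀, …, cₙ`: the entry `c k j` is the coefficient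
of `γ ^ j` in `cₖ(γ)`. -/
def fastRR {K : Type} (n d : ℕ) (c : Fin (n + 1) → Fin (d + 1) → K) :
    Prog K (FastRRData K) := do
  -- the coefficients `c₀, …, cₘ` up to the last one that is not identically zero
  let rows ← Prog.trimRows (List.ofFn fun k => List.ofFn (c k))
  match rows.getLast? with
  | none => pure ⟨[], [], []⟩
  | some top => do
    -- Step 1: `2 d n` points at which `cₘ` does not vanish, among `2 d n + d` candidates
    let good ← Prog.goodPoints top (List.range (2 * d * n + d))
    let nodes := good.take (2 * d * n)
    let points := nodes.map Prod.fst
    -- Step 2: the subresultants of `p_γ` at these points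
    let sres ← Prog.mapList (fun x => do
      let p ← Prog.mapList (fun row => Prog.evalAt row x) rows
      Prog.allSRes p) points
    -- Step 3: the values `q_k(γ) = cₘ(γ)⁻¹ * sRes_(m-k)(p_γ)` for `k = 1, …, m`,
    -- and `q_k(γ) = 0` for `k = m + 1, …, n`
    let values ← Prog.mapList (fun a => do
      let l ← Prog.divL a.2.reverse a.1
      let z ← Prog.zeros (n - l.length)
      pure (l ++ z)) ((nodes.map Prod.snd).zip sres)
    -- Step 4: interpolation of `q₁, …, qₙ`
    let weights ← Prog.nodeWeights [] points
    let output ← Prog.mapList (fun k =>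
      Prog.interpolate points weights (values.filterMap fun row => row[k]?)) (List.range n)
    pure ⟨points, sres, output⟩


/-!
Read the coefficients of `p` and `p'` from the leading one downwards, as power series `f` and `g`.
The `k`-th subresultant of `p` and `p'` is then a determinant whose rows are shifts of `f` and `g`.
Such determinants only pick up a power of the constant coefficient of `u` when `(f, g)` is replaced
by `(f u, g u)`; taking `u = f⁻¹` and noting that `g / f` is the generating series of the power sums
of the roots leaves a Hankel determinant of power sums. By the Cauchy–Binet formula the latter is a
sum of squared Vandermonde determinants, which is a subdiscriminant.

In the matrix of `sRes_(m-k)` for the generic member of the family every entry has degree at most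
`d` and the first column is divisible by `c_m`. Hence `sRes_(m-k) / c_m` is a polynomial in `γ` of
degree at most `2 (k - 1) d < 2 d n`, which is determined by its values at `2 d n` points.

One division with remainder amounts to row operations on the determinants. This is the recursion
of the signed Euclidean algorithm, whose number of operations telescopes to a quadratic one.
The interpolation of one polynomial from `N` values costs `O(√8 ^ (log₂ N)) = O(N ^ (3 / 2))`
operations, because the exponent `log₃ 5` of Toom–Cook multiplication is less than `3 / 2`, that is,
`25 < 27`; with `N = O(n²)` this is `O(n³)` for each of the `n` output polynomials.
-/

/-! ## Determinants of shifted power series -/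

section Subdet

open PowerSeries (coeff)

variable {R : Type*} [CommRing R]

lemma det_eq_of_row_eq_add_smul_of_lt {ι : Type*} [Fintype ι] [LinearOrder ι]
    {A B : Matrix ι ι R} (c : ι → R) (σ : ι → ι) (hσ : ∀ i, c i ≠ 0 → i < σ i)
    (h : ∀ i j, A i j = B i j + c i * B (σ i) j) : A.det = B.det := by
  classical
  let L : Matrix ι ι R := Matrix.of fun i k => (if i = k then 1 else 0) + if σ i = k then c i else 0
  have not_lt_of_le {i k : ι} (hki : k ≤ i) : (if σ i = k then c i else 0) = 0 := by
    split_ifs with hk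
    · by_contra hc
      exact (hσ i hc).not_ge (hk.trans_le hki)
    · rfl
  have hL : L.det = 1 := by
    rw [Matrix.det_of_isUpperTriangular (M := L)]
    · exact Finset.prod_eq_one fun i _ => by simp [L, not_lt_of_le le_rfl]
    · intro i k (hki : k < i)
      simp [L, hki.ne', not_lt_of_le hki.le]
  have hA : A = L * B := by
    ext i j
    simp [L, Matrix.mul_apply, add_mul, Finset.sum_add_distrib, h]
  rw [hA, Matrix.det_mul, hL, one_mul]

/-- The `N × N` matrix whose rows are the coefficients of `f, X f, …, X ^ (a - 1) f` and of
`X ^ (N - 1 - a) g, …, X g, g`. Matrices of subresultants are of this form, where `f` and `g` are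
the two polynomials with their coefficients in reverse order. -/
noncomputable def subdetMatrix (N a : ℕ) (f g : PowerSeries R) : Matrix (Fin N) (Fin N) R :=
  Matrix.of fun i j => coeff (j : ℕ)
    (if (i : ℕ) < a then PowerSeries.X ^ (i : ℕ) * f else PowerSeries.X ^ (N - 1 - i) * g)

/-- The determinant of `subdetMatrix`: a subresultant expressed by power series. -/
noncomputable def subdet (N a : ℕ) (f g : PowerSeries R) : R := (subdetMatrix N a f g).det

/-- The sign of the permutation that reverses `n` elements, as an element of `R`. -/
def revSign (R : Type*) [CommRing R] (n : ℕ) : R := (-1) ^ (n * (n - 1) / 2)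

lemma revSign_succ (n : ℕ) : revSign R (n + 1) = (-1) ^ n * revSign R n := by
  simp only [revSign, ← Nat.choose_two_right, Nat.choose_succ_succ' n 1, Nat.choose_one_right,
    pow_add]

lemma revSign_add_add_mul_neg_one_pow (a n : ℕ) :
    revSign R (a + a + n) * (-1) ^ a = revSign R n := by
  induction a with
  | zero => simp
  | succ a ih =>
    rw [show a + 1 + (a + 1) + n = a + a + n + 1 + 1 by omega, revSign_succ, revSign_succ, ← ih]
    have hsign : ((-1 : R) ^ (a + a + n)) * (-1) ^ (a + a + n) = 1 := by
      rw [← mul_pow]; simp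
    linear_combination revSign R (a + a + n) * (-1) ^ a * hsign

lemma det_antidiagonal (n : ℕ) :
    (Matrix.of fun i j : Fin n => if (i : ℕ) + j + 1 = n then (1 : R) else 0).det
      = revSign R n := by
  induction n with
  | zero => simp [revSign]
  | succ n ih =>
    rw [Matrix.det_succ_column_zero, Finset.sum_eq_single (Fin.last n), revSign_succ, ← ih]
    · simp only [Fin.val_last, Matrix.of_apply, Fin.val_zero, add_zero, if_true, mul_one]
      congr 2
      ext i j
      simp only [Matrix.submatrix_apply, Matrix.of_apply, Fin.succAbove_last, Fin.val_castSucc,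
        Fin.val_succ]
      exact if_congr (by omega) rfl rfl
    · intro i _ hi
      have : (i : ℕ) ≠ n := fun h => hi (Fin.ext h)
      simp [this]
    · simp

lemma subdet_swap {N a : ℕ} (ha : a ≤ N) (f g : PowerSeries R) :
    subdet N a f g = revSign R N * subdet N (N - a) g f := by
  rw [← det_antidiagonal, subdet, subdet, ← Matrix.det_mul]
  congr 1
  ext i j
  rw [Matrix.mul_apply, Finset.sum_eq_single i.rev]
  · have hrev : (i : ℕ) + (i.rev : ℕ) + 1 = N := by rw [Fin.val_rev]; omega
    rw [Matrix.of_apply, if_pos hrev, one_mul]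
    simp only [subdetMatrix, Matrix.of_apply, Fin.val_rev]
    by_cases hia : (i : ℕ) < a
    · rw [if_pos hia, if_neg (by omega), show N - 1 - (N - ((i : ℕ) + 1)) = i by omega]
    · rw [if_neg hia, if_pos (by omega), show N - ((i : ℕ) + 1) = N - 1 - i by omega]
  · intro k _ hk
    have : ¬ ((i : ℕ) + k + 1 = N) := fun h => hk (Fin.ext (by rw [Fin.val_rev]; omega))
    simp [this]
  · simp

lemma subdet_self (N : ℕ) (f g : PowerSeries R) : subdet N N f g = coeff 0 f ^ N := by
  have htri : (subdetMatrix N N f g).BlockTriangular id := by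
    intro i j (hij : (j : ℕ) < i)
    simp only [subdetMatrix, Matrix.of_apply, if_pos i.2, PowerSeries.coeff_X_pow_mul']
    rw [if_neg (by omega)]
  rw [subdet, Matrix.det_of_isUpperTriangular htri]
  simp [subdetMatrix, PowerSeries.coeff_X_pow_mul']

lemma subdet_zero (N : ℕ) (f g : PowerSeries R) :
    subdet N 0 f g = revSign R N * coeff 0 g ^ N := by
  rw [subdet_swap (Nat.zero_le N), Nat.sub_zero, subdet_self]

lemma coeff_mul_eq_sum_coeff_X_pow_mul {N : ℕ} (j : Fin N) (w u : PowerSeries R) :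
    coeff (j : ℕ) (w * u)
      = ∑ k : Fin N, coeff (k : ℕ) w * coeff (j : ℕ) (PowerSeries.X ^ (k : ℕ) * u) := by
  rw [PowerSeries.coeff_mul, Finset.Nat.sum_antidiagonal_eq_sum_range_succ
      (fun x y => coeff x w * coeff y u),
    Fin.sum_univ_eq_sum_range (fun k => coeff k w * coeff (j : ℕ) (PowerSeries.X ^ k * u)) N,
    ← Finset.sum_subset (Finset.range_subset_range.2 (Nat.succ_le_of_lt j.2))]
  · refine Finset.sum_congr rfl fun k hk => ?_
    rw [PowerSeries.coeff_X_pow_mul', if_pos (Finset.mem_range_succ_iff.1 hk)]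
  · intro k _ hk
    rw [PowerSeries.coeff_X_pow_mul', if_neg (mt Finset.mem_range_succ_iff.2 hk), mul_zero]

lemma subdet_mul (N a : ℕ) (f g u : PowerSeries R) :
    subdet N a (f * u) (g * u) = coeff 0 u ^ N * subdet N a f g := by
  have hfactor :
      subdetMatrix N a (f * u) (g * u) = subdetMatrix N a f g * subdetMatrix N N u u := by
    ext i j
    simp only [Matrix.mul_apply, subdetMatrix, Matrix.of_apply, Fin.is_lt, if_true]
    rw [← coeff_mul_eq_sum_coeff_X_pow_mul]
    split_ifs <;> rw [mul_assoc]
  rw [subdet, hfactor, Matrix.det_mul, mul_comm, ← subdet_self N u u]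
  rfl

lemma subdet_sub_C_mul_X_pow_mul {N a e : ℕ} (h : a + a + e ≤ N) (x : R) (f g : PowerSeries R) :
    subdet N a (f - PowerSeries.C x * (PowerSeries.X ^ e * g)) g = subdet N a f g := by
  refine det_eq_of_row_eq_add_smul_of_lt (fun i => if (i : ℕ) < a then -x else 0)
    (fun i => ⟨N - 1 - (i + e), by omega⟩) ?_ ?_
  · intro i hi
    have hia : (i : ℕ) < a := by
      by_contra hia
      simp [hia] at hi
    rw [Fin.lt_def]
    simp only
    omega
  · intro i j
    by_cases hia : (i : ℕ) < a
    · have hindex : N - 1 - (N - 1 - ((i : ℕ) + e)) = i + e := by omega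
      simp only [subdetMatrix, Matrix.of_apply, if_pos hia]
      rw [if_neg (by omega), hindex, mul_sub, map_sub, mul_left_comm, PowerSeries.coeff_C_mul,
        ← mul_assoc, ← pow_add]
      ring
    · simp [subdetMatrix, hia]

lemma coe_polynomial_mul_eq_sum {h : R[X]} {δ : ℕ} (hdeg : h.natDegree ≤ δ) (g : PowerSeries R) :
    (h : PowerSeries R) * g
      = ∑ i ∈ Finset.range (δ + 1), PowerSeries.C (h.coeff i) * (PowerSeries.X ^ i * g) := by
  conv_lhs => rw [h.as_sum_range_C_mul_X_pow' (Nat.lt_succ_of_le hdeg)]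
  rw [← Polynomial.coeToPowerSeries.ringHom_apply, map_sum, Finset.sum_mul]
  exact Finset.sum_congr rfl fun i _ => by rw [map_mul, map_pow]; simp [mul_assoc]

lemma subdet_sub_polynomial_mul {N a δ : ℕ} (hN : a + a + δ ≤ N) {h : R[X]}
    (hdeg : h.natDegree ≤ δ) (f g : PowerSeries R) :
    subdet N a (f - (h : PowerSeries R) * g) g = subdet N a f g := by
  have hpartial (k : ℕ) (hk : k ≤ δ + 1) : subdet N a
      (f - ∑ i ∈ Finset.range k, PowerSeries.C (h.coeff i) * (PowerSeries.X ^ i * g)) g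
        = subdet N a f g := by
    induction k with
    | zero => simp
    | succ k ih =>
      rw [Finset.sum_range_succ, ← sub_sub, subdet_sub_C_mul_X_pow_mul (by omega), ih (by omega)]
  rw [coe_polynomial_mul_eq_sum hdeg, hpartial _ le_rfl]

lemma subdet_X_mul (N b : ℕ) (f g : PowerSeries R) :
    subdet (N + 1) (b + 1) g (PowerSeries.X * f) = coeff 0 g * subdet N b g f := by
  rw [subdet, Matrix.det_succ_column_zero, Finset.sum_eq_single 0]
  · have hminor : (subdetMatrix (N + 1) (b + 1) g (PowerSeries.X * f)).submatrix
        (Fin.succAbove 0) Fin.succ = subdetMatrix N b g f := by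
      ext i j
      simp only [subdetMatrix, Matrix.submatrix_apply, Matrix.of_apply, Fin.succAbove_zero,
        Fin.val_succ, Nat.add_lt_add_iff_right]
      split_ifs
      · rw [pow_succ', mul_assoc, PowerSeries.coeff_succ_X_mul]
      · rw [mul_left_comm, PowerSeries.coeff_succ_X_mul,
          show N + 1 - 1 - ((i : ℕ) + 1) = N - 1 - i by omega]
    rw [hminor]
    simp [subdetMatrix, subdet]
  · intro i _ hi
    have hi0 : (i : ℕ) ≠ 0 := fun h => hi (Fin.ext h)
    have hentry : subdetMatrix (N + 1) (b + 1) g (PowerSeries.X * f) i 0 = 0 := by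
      simp only [subdetMatrix, Matrix.of_apply, Fin.val_zero]
      split_ifs <;> simp [hi0]
    rw [hentry, mul_zero, zero_mul]
  · simp

lemma subdet_X_pow_mul (N b e : ℕ) (f g : PowerSeries R) :
    subdet (N + e) (b + e) g (PowerSeries.X ^ e * f) = coeff 0 g ^ e * subdet N b g f := by
  induction e with
  | zero => simp
  | succ e ih =>
    rw [← add_assoc, ← add_assoc, pow_succ', mul_assoc, subdet_X_mul, ih, pow_succ', mul_assoc]

lemma subdet_X_pow_mul_eq_zero {N b e : ℕ} (hb : b < N) (he : b < e) (f g : PowerSeries R) :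
    subdet N b g (PowerSeries.X ^ e * f) = 0 := by
  obtain ⟨e', rfl⟩ : ∃ e', e = b + (e' + 1) := ⟨e - b - 1, by omega⟩
  obtain ⟨M, rfl⟩ : ∃ M, N = M + 1 + b := ⟨N - b - 1, by omega⟩
  have hshift := subdet_X_pow_mul (M + 1) 0 b (PowerSeries.X ^ (e' + 1) * f) g
  rw [zero_add] at hshift
  rw [pow_add, mul_assoc, hshift, subdet_zero]
  simp

lemma subdet_neg {N a : ℕ} (ha : a ≤ N) (f g : PowerSeries R) :
    subdet N a f (-g) = (-1) ^ (N - a) * subdet N a f g := by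
  have hsigns : ∏ i : Fin N, (if (i : ℕ) < a then (1 : R) else -1) = (-1) ^ (N - a) := by
    rw [Fin.prod_univ_eq_prod_range (fun i => if i < a then (1 : R) else -1) N]
    obtain ⟨b, rfl⟩ := Nat.exists_eq_add_of_le ha
    rw [Finset.prod_range_add, Finset.prod_eq_one, one_mul]
    · simp
    · exact fun i hi => if_pos (Finset.mem_range.1 hi)
  rw [← hsigns, subdet, subdet, ← Matrix.det_mul_column]
  congr 1
  ext i j
  simp only [subdetMatrix, Matrix.of_apply]
  split_ifs <;> simp

lemma subdet_map {S : Type*} [CommRing S] (φ : R →+* S) (N a : ℕ) (f g : PowerSeries R) :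
    φ (subdet N a f g) = subdet N a (PowerSeries.map φ f) (PowerSeries.map φ g) := by
  rw [subdet, RingHom.map_det, subdet]
  congr 1
  ext i j
  simp only [subdetMatrix, RingHom.mapMatrix_apply, Matrix.map_apply, Matrix.of_apply]
  rw [← PowerSeries.coeff_map, apply_ite (PowerSeries.map φ)]
  simp only [map_mul, map_pow, PowerSeries.map_X]

lemma subdet_eq_of_eq_mul_sub {a δ e : ℕ} {f g r : PowerSeries R} {h : R[X]}
    (hdeg : h.natDegree ≤ δ) (hf : f = (h : PowerSeries R) * g - PowerSeries.X ^ e * r) :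
    subdet (a + a + δ) a f g
      = revSign R δ * subdet (a + a + δ) (a + δ) g (PowerSeries.X ^ e * r) := by
  have hsub : f - (h : PowerSeries R) * g = -(PowerSeries.X ^ e * r) := by rw [hf]; ring
  rw [← subdet_sub_polynomial_mul le_rfl hdeg, hsub, subdet_swap (by omega),
    show a + a + δ - a = a + δ by omega, subdet_neg (by omega),
    show a + a + δ - (a + δ) = a by omega, ← mul_assoc, revSign_add_add_mul_neg_one_pow]

end Subdet

/-! ## Subdiscriminants as subresultants -/

section CauchyBinet

open Matrix

variable {R : Type*} [CommRing R]

lemma det_mul_eq_sum_prod_mul_det_submatrix {m ι : Type*} [Fintype m] [DecidableEq m] [Fintype ι]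
    (A : Matrix m ι R) (B : Matrix ι m R) :
    (A * B).det = ∑ r : m → ι, (∏ i, A i (r i)) * (B.submatrix r id).det := by
  classical
  have hrows : A * B = fun i => ∑ j, A i j • B j := by
    ext i c
    simp [Matrix.mul_apply, Finset.sum_apply]
  rw [hrows]
  change Matrix.detRowAlternating.toMultilinearMap _ = _
  rw [MultilinearMap.map_sum]
  refine Finset.sum_congr rfl fun r _ => ?_
  rw [MultilinearMap.map_smul_univ]
  rfl

lemma sum_injective_eq_sum_orderEmbedding_perm {M ι : Type*} [AddCommMonoid M] [Fintype ι]
    [LinearOrder ι] {k : ℕ} (F : (Fin k → ι) → M) :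
    ∑ r : Fin k → ι with Function.Injective r, F r
      = ∑ e : Fin k ↪o ι, ∑ σ : Equiv.Perm (Fin k), F (e ∘ σ) := by
  rw [← Fintype.sum_prod_type' fun (e : Fin k ↪o ι) (σ : Equiv.Perm (Fin k)) => F (e ∘ σ)]
  refine (Finset.sum_bij (fun p _ => p.1 ∘ p.2) ?_ ?_ ?_ fun _ _ => rfl).symm
  · rintro ⟨e, σ⟩ -
    simpa using e.injective
  · rintro ⟨e, σ⟩ - ⟨e', τ⟩ - (h : e ∘ σ = e' ∘ τ)
    have he : e = e' := by
      refine DFunLike.coe_injective ((e.strictMono.range_inj e'.strictMono).1 ?_)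
      rw [← EquivLike.range_comp e σ, h, EquivLike.range_comp]
    subst he
    have hσ : σ = τ := Equiv.ext fun i => e.injective (congrFun h i)
    rw [hσ]
  · intro r hr
    have hinj : Function.Injective r := (Finset.mem_filter.1 hr).2
    have hmono : StrictMono (r ∘ Tuple.sort r) :=
      (Tuple.monotone_sort r).strictMono_of_injective (hinj.comp (Tuple.sort r).injective)
    refine ⟨(OrderEmbedding.ofStrictMono _ hmono, (Tuple.sort r).symm), Finset.mem_univ _, ?_⟩
    ext i
    simp

lemma det_mul_eq_sum_orderEmbedding {ι : Type*} [Fintype ι] [LinearOrder ι] {k : ℕ}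
    (A : Matrix (Fin k) ι R) (B : Matrix ι (Fin k) R) :
    (A * B).det = ∑ e : Fin k ↪o ι, (A.submatrix id e).det * (B.submatrix e id).det := by
  have hinj (r : Fin k → ι) (hr : (∏ i, A i (r i)) * (B.submatrix r id).det ≠ 0) :
      Function.Injective r := by
    intro i j hij
    by_contra hne
    exact hr (by rw [Matrix.det_zero_of_row_eq hne (by ext c; simp [hij]), mul_zero])
  rw [det_mul_eq_sum_prod_mul_det_submatrix, ← Finset.sum_filter_of_ne fun r _ => hinj r,
    sum_injective_eq_sum_orderEmbedding_perm]
  refine Finset.sum_congr rfl fun e _ => ?_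
  rw [← Matrix.det_transpose (A.submatrix id e), Matrix.det_apply', Finset.sum_mul]
  refine Finset.sum_congr rfl fun σ _ => ?_
  have hperm : B.submatrix (e ∘ σ) id = (B.submatrix e id).submatrix σ id := rfl
  rw [hperm, Matrix.det_permute]
  simp only [Matrix.transpose_apply, Matrix.submatrix_apply, id, Function.comp_apply]
  ring

lemma prod_map_orderEmbedding_pairs {M ι : Type*} [CommMonoid M] [LinearOrder ι] {k : ℕ}
    (e : Fin k ↪o ι) (F : ι → ι → M) :
    ∏ i ∈ Finset.univ.map e.toEmbedding, ∏ j ∈ Finset.univ.map e.toEmbedding with i < j, F i j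
      = ∏ i, ∏ j ∈ Finset.Ioi i, F (e i) (e j) := by
  rw [Finset.prod_map]
  refine Finset.prod_congr rfl fun i _ => ?_
  rw [Finset.filter_map, Finset.prod_map]
  refine Finset.prod_congr ?_ fun _ _ => rfl
  ext j
  simp

lemma sum_powersetCard_eq_sum_orderEmbedding {M ι : Type*} [AddCommMonoid M] [Fintype ι]
    [LinearOrder ι] (k : ℕ) (F : Finset ι → M) :
    ∑ S ∈ (Finset.univ : Finset ι).powersetCard k, F S
      = ∑ e : Fin k ↪o ι, F (Finset.univ.map e.toEmbedding) := by
  refine (Finset.sum_bij (fun e _ => Finset.univ.map e.toEmbedding) ?_ ?_ ?_ fun _ _ => rfl).symm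
  · intro e _
    simp [Finset.mem_powersetCard]
  · intro e _ e' _ h
    refine DFunLike.coe_injective ((e.strictMono.range_inj e'.strictMono).1 ?_)
    simpa using congrArg (fun S : Finset ι => (S : Set ι)) h
  · intro S hS
    have hcard := (Finset.mem_powersetCard.1 hS).2
    exact ⟨S.orderEmbOfFin hcard, Finset.mem_univ _, S.map_orderEmbOfFin_univ hcard⟩

lemma det_powerSums_eq_sum_powersetCard {ι : Type*} [Fintype ι] [LinearOrder ι] (k : ℕ)
    (x : ι → R) :
    (Matrix.of fun r c : Fin k => ∑ i, x i ^ ((r : ℕ) + c)).det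
      = ∑ S ∈ (Finset.univ : Finset ι).powersetCard k,
          ∏ i ∈ S, ∏ j ∈ S with i < j, (x i - x j) ^ 2 := by
  let V : Matrix ι (Fin k) R := Matrix.of fun i c => x i ^ (c : ℕ)
  have hfactor : (Matrix.of fun r c : Fin k => ∑ i, x i ^ ((r : ℕ) + c)) = Vᵀ * V := by
    ext r c
    simp [V, Matrix.mul_apply, pow_add]
  rw [hfactor, det_mul_eq_sum_orderEmbedding, sum_powersetCard_eq_sum_orderEmbedding]
  refine Finset.sum_congr rfl fun e _ => ?_
  have hvandermonde : V.submatrix e id = Matrix.vandermonde (x ∘ e) := rfl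
  rw [← Matrix.transpose_submatrix, Matrix.det_transpose, hvandermonde, Matrix.det_vandermonde,
    prod_map_orderEmbedding_pairs e fun i j => (x i - x j) ^ 2, ← Finset.prod_mul_distrib]
  refine Finset.prod_congr rfl fun i _ => ?_
  rw [← Finset.prod_mul_distrib]
  refine Finset.prod_congr rfl fun j _ => ?_
  rw [Function.comp_apply, Function.comp_apply]
  ring

end CauchyBinet

section PowerSums

variable {R : Type*} [CommRing R]

lemma subdet_one_left (k b : ℕ) (S : PowerSeries R) :
    subdet (k + b) k 1 S = (Matrix.of fun r c : Fin b =>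
      PowerSeries.coeff (k + c) (PowerSeries.X ^ (b - 1 - r) * S)).det := by
  have hblocks : (subdetMatrix (k + b) k 1 S).submatrix finSumFinEquiv finSumFinEquiv
      = Matrix.fromBlocks 1 0
        (Matrix.of fun (r : Fin b) (c : Fin k) =>
          PowerSeries.coeff c (PowerSeries.X ^ (b - 1 - r) * S))
        (Matrix.of fun r c : Fin b =>
          PowerSeries.coeff (k + c) (PowerSeries.X ^ (b - 1 - r) * S)) := by
    have hindex (r : ℕ) : k + b - 1 - (k + r) = b - 1 - r := by omega
    ext i j
    rcases i with i | i <;> rcases j with j | j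
    · simp [subdetMatrix, PowerSeries.coeff_X_pow, Matrix.one_apply, Fin.ext_iff, eq_comm]
    · have : k + (j : ℕ) ≠ i := by omega
      simp [subdetMatrix, PowerSeries.coeff_X_pow, this]
    · simp [subdetMatrix, hindex]
    · simp [subdetMatrix, hindex]
  rw [subdet, ← Matrix.det_submatrix_equiv_self finSumFinEquiv, hblocks,
    Matrix.det_fromBlocks_zero₁₂, Matrix.det_one, one_mul]

lemma subdet_one_left_powerSums {ι : Type*} [Fintype ι] [LinearOrder ι] (k : ℕ) (x : ι → R) :
    subdet (k + (k + 1)) k 1 (PowerSeries.mk fun m => ∑ i, x i ^ m)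
      = ∑ S ∈ (Finset.univ : Finset ι).powersetCard (k + 1),
          ∏ i ∈ S, ∏ j ∈ S with i < j, (x i - x j) ^ 2 := by
  rw [subdet_one_left, ← det_powerSums_eq_sum_powersetCard]
  congr 1
  ext r c
  simp only [Matrix.of_apply]
  rw [PowerSeries.coeff_X_pow_mul', if_pos (by omega), PowerSeries.coeff_mk,
    show k + (c : ℕ) - (k + 1 - 1 - r) = r + c by omega]

lemma one_sub_mul_mk_pow (x : R) :
    (1 - PowerSeries.C x * PowerSeries.X) * PowerSeries.mk (fun n => x ^ n) = 1 := by
  ext n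
  rw [sub_mul, one_mul, mul_assoc, map_sub, PowerSeries.coeff_C_mul]
  cases n with
  | zero => simp
  | succ n =>
    rw [PowerSeries.coeff_succ_X_mul]
    simp [PowerSeries.coeff_one, pow_succ']

lemma reflect_X_sub_C_mul (x : R) {P : R[X]} {N : ℕ} (hP : P.natDegree ≤ N) :
    ((X - C x) * P).reflect (N + 1) = (1 - C x * X) * P.reflect N := by
  rw [add_comm, reflect_mul _ _ (natDegree_X_sub_C_le x) hP, reflect_sub, reflect_one_X, reflect_C,
    pow_one]

lemma reflect_derivative_X_sub_C_mul (x : R) {P : R[X]} {N : ℕ} (hP : P.natDegree ≤ N) :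
    ((X - C x) * P).derivative.reflect N
      = P.reflect N + (1 - C x * X) * P.derivative.reflect (N - 1) := by
  rw [derivative_mul, derivative_X_sub_C, one_mul, reflect_add]
  cases N with
  | zero => simp [derivative_of_natDegree_zero (Nat.le_zero.1 hP)]
  | succ N =>
    rw [Nat.add_sub_cancel, reflect_X_sub_C_mul x ((natDegree_derivative_le P).trans (by omega))]

/-- With reversed coefficients this is `P' / P = ∑ᵢ 1 / (X - xᵢ)` for `P = ∏ᵢ (X - xᵢ)`. -/
lemma reflect_derivative_prod_X_sub_C [Nontrivial R] (l : List R) :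
    (((l.map fun x => X - C x).prod.derivative.reflect (l.length - 1) : R[X]) : PowerSeries R)
      = (((l.map fun x => X - C x).prod.reflect l.length : R[X]) : PowerSeries R)
        * PowerSeries.mk fun m => (l.map fun x => x ^ m).sum := by
  induction l with
  | nil => ext; simp
  | cons x l ih =>
    have hdeg : (l.map fun x => X - C x).prod.natDegree = l.length := by
      simpa using natDegree_multiset_prod_X_sub_C_eq_card (l : Multiset R)
    have hsum : (PowerSeries.mk fun m => ((x :: l).map fun x => x ^ m).sum)
        = PowerSeries.mk (fun m => x ^ m) + PowerSeries.mk fun m => (l.map fun x => x ^ m).sum := by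
      ext m
      simp
    rw [List.map_cons, List.prod_cons, List.length_cons, Nat.add_sub_cancel,
      reflect_X_sub_C_mul x hdeg.le, reflect_derivative_X_sub_C_mul x hdeg.le, hsum]
    push_cast at ih ⊢
    rw [ih]
    linear_combination
      -((l.map fun x => X - C x).prod.reflect l.length : PowerSeries R) * one_sub_mul_mk_pow x

end PowerSums

lemma shiftedRow_eq_coeff {f : ℝ[X]} {e : ℕ} (hf : f.natDegree ≤ e) (s j : ℕ) :
    shiftedRow f e s j =
      PowerSeries.coeff j (PowerSeries.X ^ s * ((f.reflect e : ℝ[X]) : PowerSeries ℝ)) := by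
  rw [PowerSeries.coeff_X_pow_mul', shiftedRow, Polynomial.coeff_coe, coeff_reflect]
  by_cases hs : s ≤ j
  · by_cases hj : j ≤ e + s
    · rw [if_pos ⟨hs, hj⟩, if_pos hs, revAt_le (by omega)]
      congr 1
      omega
    · rw [if_neg (fun h => hj h.2), if_pos hs, revAt_eq_self_of_lt (by omega),
        coeff_eq_zero_of_natDegree_lt (by omega)]
  · rw [if_neg (fun h => hs h.1), if_neg hs]

lemma sRes_eq_subdet (k : ℕ) (p : ℝ[X]) :
    sRes k p = subdet (2 * p.natDegree - 1 - 2 * k) (p.natDegree - 1 - k)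
      ((p.reflect p.natDegree : ℝ[X]) : PowerSeries ℝ)
      ((p.derivative.reflect (p.natDegree - 1) : ℝ[X]) : PowerSeries ℝ) := by
  simp only [sRes, subdet]
  congr 1
  ext i j
  simp only [Matrix.of_apply, subdetMatrix]
  rw [shiftedRow_eq_coeff le_rfl, shiftedRow_eq_coeff (natDegree_derivative_le p),
    show 2 * p.natDegree - 1 - 2 * k - 1 - (i : ℕ) = 2 * p.natDegree - 2 - 2 * k - i by omega]
  split_ifs <;> rfl

lemma coeff_zero_reflect_natDegree {R : Type*} [Semiring R] (P : R[X]) :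
    PowerSeries.coeff 0 ((P.reflect P.natDegree : R[X]) : PowerSeries R) = P.leadingCoeff := by
  rw [Polynomial.coeff_coe, coeff_reflect, revAt_le (Nat.zero_le _), Nat.sub_zero, leadingCoeff]

lemma map_coe_reflect {R S : Type*} [CommSemiring R] [CommSemiring S] (φ : R →+* S) (e : ℕ)
    (f : R[X]) :
    PowerSeries.map φ ((f.reflect e : R[X]) : PowerSeries R)
      = (((f.map φ).reflect e : S[X]) : PowerSeries S) := by
  rw [← polynomial_map_coe, reflect_map]

section Roots

variable {F : Type*} [Field F]

lemma eq_C_leadingCoeff_mul_prod_roots_toList {P : F[X]} (hP : P.Splits) :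
    P = C P.leadingCoeff * (P.roots.toList.map fun x => X - C x).prod := by
  conv_lhs => rw [← C_leadingCoeff_mul_prod_multiset_X_sub_C (splits_iff_card_roots.1 hP),
    ← Multiset.coe_toList P.roots, Multiset.map_coe, Multiset.prod_coe]

lemma reflect_derivative_eq_powerSums_mul_reflect {P : F[X]} (hP : P.Splits) :
    ((P.derivative.reflect (P.natDegree - 1) : F[X]) : PowerSeries F)
      = (PowerSeries.mk fun m => ∑ i, P.roots.toList.get i ^ m)
        * ((P.reflect P.natDegree : F[X]) : PowerSeries F) := by
  have hlen : P.natDegree = P.roots.toList.length := by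
    rw [Multiset.length_toList, splits_iff_card_roots.1 hP]
  have hprod := eq_C_leadingCoeff_mul_prod_roots_toList hP
  have hsum (m : ℕ) : ∑ i, P.roots.toList.get i ^ m = (P.roots.toList.map fun x => x ^ m).sum :=
    Fin.sum_univ_fun_getElem P.roots.toList fun x => x ^ m
  simp only [hsum]
  generalize P.roots.toList = l at hlen hprod ⊢
  generalize P.leadingCoeff = a at hprod
  rw [hlen, hprod, derivative_C_mul, reflect_C_mul, reflect_C_mul]
  push_cast
  rw [reflect_derivative_prod_X_sub_C]
  ring

lemma subdet_reflect_derivative {P : F[X]} (hP : P.Splits) (k : ℕ) :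
    subdet (k + (k + 1)) k ((P.reflect P.natDegree : F[X]) : PowerSeries F)
        ((P.derivative.reflect (P.natDegree - 1) : F[X]) : PowerSeries F)
      = P.leadingCoeff ^ (k + (k + 1)) *
        ∑ S ∈ (Finset.univ : Finset (Fin P.roots.toList.length)).powersetCard (k + 1),
          ∏ i ∈ S, ∏ j ∈ S with i < j, (P.roots.toList.get i - P.roots.toList.get j) ^ 2 := by
  have hmul := subdet_mul (k + (k + 1)) k 1 (PowerSeries.mk fun m => ∑ i, P.roots.toList.get i ^ m)
    ((P.reflect P.natDegree : F[X]) : PowerSeries F)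
  rw [one_mul, subdet_one_left_powerSums, coeff_zero_reflect_natDegree] at hmul
  rw [reflect_derivative_eq_powerSums_mul_reflect hP, hmul]

end Roots

theorem sRes_eq_leadingCoeff_mul_sDisc {k : ℕ} {p : ℝ[X]} (hk : k < p.natDegree) :
    ((sRes (p.natDegree - (k + 1)) p : ℝ) : ℂ) = (p.leadingCoeff : ℂ) * sDisc (k + 1) p := by
  have hdeg : (p.map (algebraMap ℝ ℂ)).natDegree = p.natDegree := natDegree_map _
  have hlead : (p.map (algebraMap ℝ ℂ)).leadingCoeff = (p.leadingCoeff : ℂ) := leadingCoeff_map _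
  have hexponent : 2 * ((k + 1 : ℕ) : ℤ) - 2 = ((k + k : ℕ) : ℤ) := by push_cast; ring
  have hsubdet := subdet_reflect_derivative (IsAlgClosed.splits (p.map (algebraMap ℝ ℂ))) k
  rw [hdeg, hlead, derivative_map, ← map_coe_reflect, ← map_coe_reflect, ← subdet_map] at hsubdet
  rw [sRes_eq_subdet, show 2 * p.natDegree - 1 - 2 * (p.natDegree - (k + 1)) = k + (k + 1) by omega,
    show p.natDegree - 1 - (p.natDegree - (k + 1)) = k by omega, sDisc, hexponent, zpow_natCast,
    ← mul_assoc, ← pow_succ']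
  exact hsubdet

lemma sDisc_eq_zero {k : ℕ} {p : ℝ[X]} (hk : p.natDegree < k) : sDisc k p = 0 := by
  have hcard : (p.map (algebraMap ℝ ℂ)).roots.toList.length < k := by
    rw [Multiset.length_toList]
    exact ((card_roots' _).trans natDegree_map_le).trans_lt hk
  simp only [sDisc]
  rw [Finset.powersetCard_eq_empty.2 (by simpa using hcard), Finset.sum_empty, mul_zero]

/-! ## Lagrange interpolation on lists -/

section Lagrange

variable {R : Type*} [CommRing R]

/-- The nodal polynomial `∏ᵢ (X - xᵢ)` of a list of points. -/
noncomputable def nodal (xs : List R) : R[X] := (xs.map fun x => X - C x).prod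

/-- The sum of `uᵢ ∏_{j ≠ i} (X - xⱼ)` over the pairs `(xᵢ, uᵢ)` of the list. -/
noncomputable def lagrangeSum : List (R × R) → R[X]
  | [] => 0
  | a :: l => C a.2 * nodal (l.map Prod.fst) + (X - C a.1) * lagrangeSum l

/-- The product of the differences of `x` to the other entries of a list without repetitions. -/
def nodeWeight [DecidableEq R] (xs : List R) (x : R) : R := ((xs.erase x).map fun y => x - y).prod

lemma nodal_append (l₁ l₂ : List R) : nodal (l₁ ++ l₂) = nodal l₁ * nodal l₂ := by
  simp [nodal]

lemma nodal_cons (x : R) (l : List R) : nodal (x :: l) = (X - C x) * nodal l := by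
  simp [nodal]

lemma eval_nodal (x : R) (l : List R) : (nodal l).eval x = (l.map fun y => x - y).prod := by
  induction l with
  | nil => simp [nodal]
  | cons y l ih => simp [nodal_cons, ih]

lemma lagrangeSum_append (l₁ l₂ : List (R × R)) :
    lagrangeSum (l₁ ++ l₂)
      = lagrangeSum l₁ * nodal (l₂.map Prod.fst) + lagrangeSum l₂ * nodal (l₁.map Prod.fst) := by
  induction l₁ with
  | nil => simp [lagrangeSum, nodal]
  | cons a l₁ ih =>
    rw [List.cons_append, lagrangeSum, lagrangeSum, ih, List.map_append, nodal_append,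
      List.map_cons, nodal_cons]
    ring

lemma degree_nodal [Nontrivial R] (l : List R) : (nodal l).degree = l.length := by
  induction l with
  | nil => simp [nodal]
  | cons x l ih =>
    rw [nodal_cons, mul_comm, (monic_X_sub_C x).degree_mul, ih, degree_X_sub_C, List.length_cons]
    rfl

lemma degree_lagrangeSum_lt [Nontrivial R] (l : List (R × R)) :
    (lagrangeSum l).degree < l.length := by
  induction l with
  | nil => simp [lagrangeSum]
  | cons a l ih =>
    rw [lagrangeSum, List.length_cons]
    refine (degree_add_le _ _).trans_lt (max_lt ?_ ?_)
    · rw [← smul_eq_C_mul]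
      refine (degree_smul_le _ _).trans_lt ?_
      rw [degree_nodal, List.length_map]
      exact_mod_cast Nat.lt_succ_self _
    · rw [mul_comm, (monic_X_sub_C a.1).degree_mul, degree_X_sub_C]
      push_cast
      exact WithBot.add_lt_add_right (by simp) ih

lemma eval_lagrangeSum [DecidableEq R] (u : R → R) {xs : List R} {x : R} (hx : x ∈ xs) :
    (lagrangeSum (xs.map fun x => (x, u x))).eval x = u x * nodeWeight xs x := by
  induction xs with
  | nil => simp at hx
  | cons y l ih =>
    have hfst : (l.map fun x => (x, u x)).map Prod.fst = l := by simp [Function.comp_def]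
    rw [List.map_cons, lagrangeSum, hfst]
    simp only [eval_add, eval_mul, eval_C, eval_sub, eval_X, eval_nodal]
    by_cases hxy : x = y
    · subst hxy
      simp [nodeWeight]
    · have hl : x ∈ l := (List.mem_cons.1 hx).resolve_left hxy
      have hzero : (l.map fun y => x - y).prod = 0 :=
        List.prod_eq_zero (List.mem_map.2 ⟨x, hl, sub_self x⟩)
      have hweight : nodeWeight (y :: l) x = (x - y) * nodeWeight l x := by
        rw [nodeWeight, List.erase_cons_tail (by simpa using Ne.symm hxy), List.map_cons,
          List.prod_cons, nodeWeight]
      rw [hzero, ih hl, hweight]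
      ring

lemma nodeWeight_ne_zero [IsDomain R] [DecidableEq R] {xs : List R} (h : xs.Nodup) (x : R) :
    nodeWeight xs x ≠ 0 := by
  refine List.prod_ne_zero fun h0 => ?_
  obtain ⟨y, hy, hxy⟩ := List.mem_map.1 h0
  exact (h.mem_erase_iff.1 hy).1 (sub_eq_zero.1 hxy).symm

end Lagrange

lemma lagrangeSum_eval_div_nodeWeight {F : Type*} [Field F] [DecidableEq F] {xs : List F}
    (h : xs.Nodup) {Q : F[X]} (hQ : Q.degree < xs.length) :
    lagrangeSum (xs.map fun x => (x, Q.eval x / nodeWeight xs x)) = Q := by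
  refine eq_of_degrees_lt_of_eval_finset_eq xs.toFinset ?_ ?_ fun x hx => ?_
  · rw [List.toFinset_card_of_nodup h]
    simpa using degree_lagrangeSum_lt (xs.map fun x => (x, Q.eval x / nodeWeight xs x))
  · rwa [List.toFinset_card_of_nodup h]
  · rw [eval_lagrangeSum (fun x => Q.eval x / nodeWeight xs x) (List.mem_toFinset.1 hx),
      div_mul_cancel₀ _ (nodeWeight_ne_zero h x)]

/-! ## Coefficient lists -/

lemma ofCoeffs_append (l h : List ℝ) :
    ofCoeffs (l ++ h) = ofCoeffs l + X ^ l.length * ofCoeffs h := by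
  induction l with
  | nil => simp [ofCoeffs]
  | cons a l ih =>
    simp only [List.cons_append, ofCoeffs, ih, List.length_cons]
    ring

lemma ofCoeffs_replicate_zero (n : ℕ) : ofCoeffs (List.replicate n 0) = 0 := by
  induction n with
  | zero => rfl
  | succ n ih => simp [List.replicate_succ, ofCoeffs, ih]

lemma ofCoeffs_map_mul (x : ℝ) (l : List ℝ) :
    ofCoeffs (l.map fun a => x * a) = C x * ofCoeffs l := by
  induction l with
  | nil => simp [ofCoeffs]
  | cons a l ih =>
    simp only [List.map_cons, ofCoeffs, ih, C_mul]
    ring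

lemma ofCoeffs_map_neg (l : List ℝ) : ofCoeffs (l.map fun a => -a) = -ofCoeffs l := by
  simpa using ofCoeffs_map_mul (-1) l

lemma coeff_ofCoeffs (l : List ℝ) (i : ℕ) : (ofCoeffs l).coeff i = l.getD i 0 := by
  induction l generalizing i with
  | nil => simp [ofCoeffs]
  | cons a l ih =>
    cases i with
    | zero => simp [ofCoeffs]
    | succ i => simp [ofCoeffs, ih, coeff_C_succ]

lemma coeff_ofCoeffs_of_length_le {l : List ℝ} {i : ℕ} (h : l.length ≤ i) :
    (ofCoeffs l).coeff i = 0 := by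
  rw [coeff_ofCoeffs, List.getD_eq_default _ _ h]

lemma ofCoeffs_take_add_drop (w : ℕ) (l : List ℝ) :
    ofCoeffs l = ofCoeffs (l.take w) + X ^ w * ofCoeffs (l.drop w) := by
  rcases le_total w l.length with h | h
  · conv_lhs => rw [← List.take_append_drop w l]
    rw [ofCoeffs_append, List.length_take, min_eq_left h]
  · rw [List.take_of_length_le h, List.drop_of_length_le h]
    simp [ofCoeffs]

lemma ofCoeffs_take_of_coeff_eq_zero {l : List ℝ} {n : ℕ}
    (h : ∀ i, n ≤ i → (ofCoeffs l).coeff i = 0) : ofCoeffs (l.take n) = ofCoeffs l := by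
  ext i
  rw [coeff_ofCoeffs]
  rcases lt_or_ge i n with hi | hi
  · rw [coeff_ofCoeffs, List.getD_eq_getElem?_getD, List.getD_eq_getElem?_getD,
      List.getElem?_take_of_lt hi]
  · rw [h i hi, List.getD_eq_default]
    exact (List.length_take_le _ _).trans hi

/-- The list `l` consists of the coefficients of `p`, constant coefficient first, possibly followed
by zeros, and has length at most `L`. This is how the programs store polynomials; the bound on the
length is what their cost depends on. -/
def Represents (p : ℝ[X]) (L : ℕ) (l : List ℝ) : Prop := ofCoeffs l = p ∧ l.length ≤ L

lemma Represents.mono {p : ℝ[X]} {L M : ℕ} {l : List ℝ} (h : Represents p L l) (hL : L ≤ M) :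
    Represents p M l :=
  ⟨h.1, h.2.trans hL⟩

lemma Represents.congr {p q : ℝ[X]} {L : ℕ} {l : List ℝ} (h : Represents p L l) (hpq : p = q) :
    Represents q L l :=
  hpq ▸ h

lemma Represents.exists_three_parts {p : ℝ[X]} {w : ℕ} {l : List ℝ}
    (h : Represents p (3 * w) l) : ∃ p₀ p₁ p₂ : ℝ[X], p = p₀ + X ^ w * (p₁ + X ^ w * p₂) ∧
      Represents p₀ w (l.take w) ∧ Represents p₁ w ((l.drop w).take w) ∧
      Represents p₂ w (l.drop (2 * w)) := by
  refine ⟨_, _, _, ?_, ⟨rfl, List.length_take_le _ _⟩, ⟨rfl, List.length_take_le _ _⟩,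
    rfl, by rw [List.length_drop]; have := h.2; omega⟩
  rw [two_mul, ← List.drop_drop, ← ofCoeffs_take_add_drop, ← ofCoeffs_take_add_drop, h.1]

namespace Prog

/-! ## Correctness and cost of programs -/

section Runs

variable {K α β : Type} [Field K] [DecidableEq K]

/-- The program `P` runs in at most `T` steps without dividing by zero, and its result satisfies
`Q`: a Hoare triple for total correctness with a cost bound. -/
def Runs (P : Prog K α) (T : ℕ) (Q : α → Prop) : Prop :=
  ∃ a t, P.run = some (a, t) ∧ t ≤ T ∧ Q a

lemma run_seq (P : Prog K α) (f : α → Prog K β) :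
    (P.seq f).run = P.run.bind fun r => (f r.1).run.map fun r' => (r'.1, r'.2 + r.2) := by
  induction P with
  | ret a => simp [seq, run]
  | const z next ih =>
    simp only [seq, run, ih]
    cases (next z).run <;> simp [Function.comp_def, add_assoc]
  | arith o x y next ih =>
    have hstep (v : K) : ((next v).seq f).run.map (fun r => (r.1, r.2 + 1))
        = ((next v).run.map fun r => (r.1, r.2 + 1)).bind
            fun r => (f r.1).run.map fun r' => (r'.1, r'.2 + r.2) := by
      rw [ih]
      cases (next v).run <;> simp [Function.comp_def, add_assoc]
    cases o with
    | add => exact hstep _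
    | sub => exact hstep _
    | mul => exact hstep _
    | div =>
      simp only [seq, run]
      split_ifs
      · rfl
      · exact hstep _
  | test x next ih =>
    simp only [seq, run, ih]
    cases (next (decide (x = 0))).run <;> simp [Function.comp_def, add_assoc]

lemma Runs.bind {P : Prog K α} {f : α → Prog K β} {T₁ T₂ : ℕ} {Q : α → Prop} {Q' : β → Prop}
    (hP : Runs P T₁ Q) (hf : ∀ a, Q a → Runs (f a) T₂ Q') : Runs (P >>= f) (T₁ + T₂) Q' := by
  obtain ⟨a, t, hrun, ht, ha⟩ := hP
  obtain ⟨b, t', hrun', ht', hb⟩ := hf a ha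
  refine ⟨b, t' + t, ?_, by omega, hb⟩
  change (P.seq f).run = _
  rw [run_seq, hrun]
  simp [hrun']

lemma Runs.pure {a : α} {Q : α → Prop} (h : Q a) : Runs (pure a : Prog K α) 0 Q :=
  ⟨a, 0, rfl, le_rfl, h⟩

lemma Runs.mono {P : Prog K α} {T T' : ℕ} {Q Q' : α → Prop} (h : Runs P T Q) (hT : T ≤ T')
    (hQ : ∀ a, Q a → Q' a) : Runs P T' Q' := by
  obtain ⟨a, t, hrun, ht, ha⟩ := h
  exact ⟨a, t, hrun, ht.trans hT, hQ a ha⟩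

lemma Runs.trans_le {P : Prog K α} {T T' : ℕ} {Q : α → Prop} (h : Runs P T Q) (hT : T ≤ T') :
    Runs P T' Q :=
  h.mono hT fun _ h => h

lemma runs_int (z : ℤ) : Runs (int z) 1 (· = (z : K)) := ⟨z, 1, rfl, le_rfl, rfl⟩

lemma runs_add (x y : K) : Runs (add x y) 1 (· = x + y) := ⟨_, 1, rfl, le_rfl, rfl⟩

lemma runs_sub (x y : K) : Runs (sub x y) 1 (· = x - y) := ⟨_, 1, rfl, le_rfl, rfl⟩

lemma runs_mul (x y : K) : Runs (mul x y) 1 (· = x * y) := ⟨_, 1, rfl, le_rfl, rfl⟩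

lemma runs_div {x y : K} (hy : y ≠ 0) : Runs (div x y) 1 (· = x / y) :=
  ⟨x / y, 1, by simp [div, run, hy], le_rfl, rfl⟩

lemma runs_isZero (x : K) : Runs (isZero x) 1 (fun b => b = true ↔ x = 0) :=
  ⟨decide (x = 0), 1, rfl, le_rfl, by simp⟩

lemma runs_mapList_forall₂ {f : α → Prog K β} {T : ℕ} {Q : α → β → Prop} (l : List α)
    (h : ∀ a ∈ l, Runs (f a) T (Q a)) : Runs (mapList f l) (l.length * T) (List.Forall₂ Q l) := by
  induction l with
  | nil => exact (Runs.pure List.Forall₂.nil).trans_le (Nat.zero_le _)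
  | cons a l ih =>
    refine Runs.trans_le (Runs.bind (h a List.mem_cons_self) fun b hb =>
      Runs.bind (ih fun a ha => h a (List.mem_cons_of_mem _ ha)) fun bs hbs =>
        Runs.pure (.cons hb hbs)) ?_
    rw [List.length_cons]
    linarith

lemma runs_mapList {f : α → Prog K β} {T : ℕ} (g : α → β) (l : List α)
    (h : ∀ a ∈ l, Runs (f a) T (· = g a)) : Runs (mapList f l) (l.length * T) (· = l.map g) := by
  refine (runs_mapList_forall₂ l h).mono le_rfl fun bs hbs => ?_
  induction hbs with
  | nil => rfl
  | cons hb _ ih => rw [hb, List.map_cons, ih fun a ha => h a (List.mem_cons_of_mem _ ha)]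

lemma runs_pow (x : K) (e : ℕ) : Runs (pow x e) (e + 1) (· = x ^ e) := by
  induction e with
  | zero => exact (runs_int 1).mono le_rfl (by simp)
  | succ e ih =>
    exact Runs.bind ih fun y hy => (runs_mul x y).mono le_rfl fun z hz => by
      rw [hz, hy, pow_succ']

lemma runs_zeros (l : ℕ) : Runs (zeros l) 1 (· = List.replicate l (0 : K)) :=
  Runs.bind (runs_int 0) fun z hz => Runs.pure (by simp [hz])

lemma runs_scaleL (x : K) (l : List K) : Runs (scaleL x l) l.length (· = l.map fun a => x * a) :=
  (runs_mapList _ l fun a _ => runs_mul x a).trans_le (mul_one _).le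

lemma runs_negL (l : List K) : Runs (negL l) (1 + l.length) (· = l.map fun a => -a) :=
  Runs.bind (runs_int 0) fun z hz => (runs_mapList (T := 1) _ l fun a _ => runs_sub z a).mono
    (mul_one _).le fun r hr => by simp [hr, hz]

lemma runs_divL {x : K} (hx : x ≠ 0) (l : List K) :
    Runs (divL l x) l.length (· = l.map fun a => a / x) :=
  (runs_mapList _ l fun _ _ => runs_div hx).trans_le (mul_one _).le

lemma runs_allZero (l : List K) :
    Runs (allZero l) l.length fun b => b = true ↔ ∀ a ∈ l, a = 0 := by
  induction l with
  | nil => exact Runs.pure (by simp)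
  | cons a l ih =>
    rw [List.length_cons, add_comm]
    refine Runs.bind (runs_isZero a) fun z hz => ?_
    cases z with
    | true => exact ih.mono le_rfl fun b hb => by simp [hb, hz.1 rfl]
    | false =>
      have ha : a ≠ 0 := fun h => by simpa using hz.2 h
      exact (Runs.pure (by simp [ha])).trans_le (Nat.zero_le _)

end Runs

/-! ## Operations on coefficient lists -/

lemma runs_addL_length (as bs : List ℝ) : Runs (addL as bs) as.length
    fun r => ofCoeffs r = ofCoeffs as + ofCoeffs bs ∧ r.length = max as.length bs.length := by
  induction as generalizing bs with
  | nil => exact (Runs.pure ⟨by simp [ofCoeffs], by simp⟩).trans_le (Nat.zero_le _)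
  | cons a as ih =>
    cases bs with
    | nil => exact (Runs.pure ⟨by simp [ofCoeffs], by simp⟩).trans_le (Nat.zero_le _)
    | cons b bs =>
      rw [List.length_cons, add_comm]
      refine Runs.bind (runs_add a b) fun s hs => Runs.bind (ih bs) fun r hr => Runs.pure ⟨?_, ?_⟩
      · simp only [ofCoeffs, hs, hr.1, C_add]
        ring
      · simp only [List.length_cons, hr.2]
        omega

lemma runs_addL {p q : ℝ[X]} {L : ℕ} {as bs : List ℝ} (ha : Represents p L as)
    (hb : Represents q L bs) : Runs (addL as bs) L (Represents (p + q) L) :=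
  (runs_addL_length as bs).mono ha.2 fun r hr =>
    ⟨by rw [hr.1, ha.1, hb.1], hr.2.trans_le (max_le ha.2 hb.2)⟩

lemma runs_scaleL_represents {p : ℝ[X]} {L : ℕ} {l : List ℝ} (x : ℝ) (h : Represents p L l) :
    Runs (scaleL x l) L (Represents (C x * p) L) :=
  (runs_scaleL x l).mono h.2 fun r hr => by
    subst hr
    exact ⟨by rw [ofCoeffs_map_mul, h.1], by simpa using h.2⟩

lemma runs_subL {p q : ℝ[X]} {L : ℕ} {as bs : List ℝ} (ha : Represents p L as)
    (hb : Represents q L bs) : Runs (subL as bs) (1 + L + L) (Represents (p - q) L) := by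
  refine Runs.bind ((runs_negL bs).trans_le (Nat.add_le_add_left hb.2 1)) fun r hr => ?_
  subst hr
  rw [sub_eq_add_neg]
  exact runs_addL ha ⟨by rw [ofCoeffs_map_neg, hb.1], by simpa using hb.2⟩

lemma runs_divL_represents {p q : ℝ[X]} {L : ℕ} {l : List ℝ} {x : ℝ} (hx : x ≠ 0)
    (h : Represents p L l) (hpq : p = C x * q) : Runs (divL l x) L (Represents q L) :=
  (runs_divL hx l).mono h.2 fun r hr => by
    subst hr
    refine ⟨?_, by simpa using h.2⟩
    simp only [div_eq_inv_mul]
    rw [ofCoeffs_map_mul, h.1, hpq, ← mul_assoc, ← C_mul, inv_mul_cancel₀ hx, C_1, one_mul]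

lemma runs_addShift {p q : ℝ[X]} {b L M N : ℕ} {l h : List ℝ} (hl : Represents p L l)
    (hh : Represents q M h) (hLN : L ≤ N) (hMN : b + M ≤ N) :
    Runs (addShift b l h) (1 + L) (Represents (p + X ^ b * q) N) := by
  refine Runs.bind (runs_zeros b) fun z hz => ?_
  subst hz
  refine (runs_addL_length l _).mono hl.2 fun r hr => ⟨?_, ?_⟩
  · rw [hr.1, ofCoeffs_append, ofCoeffs_replicate_zero, List.length_replicate, hl.1, hh.1, zero_add]
  · rw [hr.2, List.length_append, List.length_replicate]
    exact max_le (hl.2.trans hLN) ((Nat.add_le_add_left hh.2 b).trans hMN)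

lemma runs_evalAt (l : List ℝ) (x : ℝ) :
    Runs (evalAt l x) (1 + 2 * l.length) (· = (ofCoeffs l).eval x) := by
  induction l with
  | nil => exact (runs_int 0).mono le_rfl (by simp [ofCoeffs])
  | cons a l ih =>
    rw [List.length_cons, mul_add_one, ← add_assoc]
    exact Runs.bind ih fun v hv => Runs.bind (runs_mul x v) fun t ht =>
      (runs_add a t).mono le_rfl fun r hr => by simp [hr, ht, hv, ofCoeffs]

/-! ## Fast multiplication -/

/-- The last phase of `toomCook`: it recovers `c₀ + c₁ X ^ w + c₂ X ^ (2 w) + c₃ X ^ (3 w) +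
c₄ X ^ (4 w)` from `c₀`, `c₄` and the values `rp`, `rm`, `rt` of `∑ cᵢ Yⁱ` at `Y = 1, -1, 2`.
It repeats the code of `toomCook` literally, so that the two can be identified by unfolding. -/
def toomCookInterpolate {K : Type} (w : ℕ) (two three four sixteen : K)
    (c₀ rp rm rt c₄ : List K) : Prog K (List K) := do
  let u ← addL rp rm
  let u ← divL u two
  let u ← subL u c₀
  let c₂ ← subL u c₄
  let v ← subL rp rm
  let v ← divL v two
  let t ← subL rt c₀
  let c₂' ← scaleL four c₂
  let t ← subL t c₂'
  let c₄' ← scaleL sixteen c₄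
  let t ← subL t c₄'
  let t ← divL t two
  let t ← subL t v
  let c₃ ← divL t three
  let c₁ ← subL v c₃
  let h ← addShift w c₃ c₄
  let h ← addShift w c₂ h
  let h ← addShift w c₁ h
  addShift w c₀ h

lemma runs_toomCookInterpolate {w : ℕ} {c₀ c₁ c₂ c₃ c₄ : ℝ[X]} {l₀ lp lm lt l₄ : List ℝ}
    (h₀ : Represents c₀ (2 * w) l₀) (hp : Represents (c₀ + c₁ + c₂ + c₃ + c₄) (2 * w) lp)
    (hm : Represents (c₀ - c₁ + c₂ - c₃ + c₄) (2 * w) lm)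
    (ht : Represents (c₀ + 2 * c₁ + 4 * c₂ + 8 * c₃ + 16 * c₄) (2 * w) lt)
    (h₄ : Represents c₄ (2 * w) l₄) :
    Runs (toomCookInterpolate w 2 3 4 16 l₀ lp lm lt l₄) (54 * w + 12) (Represents
      (c₀ + X ^ w * (c₁ + X ^ w * (c₂ + X ^ w * (c₃ + X ^ w * c₄)))) (6 * w)) := by
  have C2 : (C 2 : ℝ[X]) = 2 := map_ofNat C 2
  have C3 : (C 3 : ℝ[X]) = 3 := map_ofNat C 3
  have C4 : (C 4 : ℝ[X]) = 4 := map_ofNat C 4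
  have C16 : (C 16 : ℝ[X]) = 16 := map_ofNat C 16
  refine Runs.trans_le (
    Runs.bind (runs_addL hp hm) fun _ hu =>
    Runs.bind (runs_divL_represents (q := c₀ + c₂ + c₄) two_ne_zero hu
      (by rw [C2]; ring)) fun _ hu =>
    Runs.bind (runs_subL hu h₀) fun _ hu =>
    Runs.bind (runs_subL hu h₄) fun _ h₂ =>
    Runs.bind (runs_subL hp hm) fun _ hv =>
    Runs.bind (runs_divL_represents (q := c₁ + c₃) two_ne_zero hv (by rw [C2]; ring)) fun _ hv =>
    Runs.bind (runs_subL ht h₀) fun _ ht =>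
    Runs.bind (runs_scaleL_represents _ h₂) fun _ h₂' =>
    Runs.bind (runs_subL ht h₂') fun _ ht =>
    Runs.bind (runs_scaleL_represents _ h₄) fun _ h₄' =>
    Runs.bind (runs_subL ht h₄') fun _ ht =>
    Runs.bind (runs_divL_represents (q := c₁ + 4 * c₃) two_ne_zero ht
      (by rw [C2, C4, C16]; ring)) fun _ ht =>
    Runs.bind (runs_subL ht hv) fun _ ht =>
    Runs.bind (runs_divL_represents (q := c₃) three_ne_zero ht (by rw [C3]; ring)) fun _ h₃ =>
    Runs.bind (runs_subL hv h₃) fun _ h₁ =>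
    Runs.bind (runs_addShift (N := 3 * w) h₃ h₄ (by omega) (by omega)) fun _ hh =>
    Runs.bind (runs_addShift (N := 4 * w) h₂ hh (by omega) (by omega)) fun _ hh =>
    Runs.bind (runs_addShift (N := 5 * w) h₁ hh (by omega) (by omega)) fun _ hh =>
    (runs_addShift (N := 6 * w) h₀ hh (by omega) (by omega)).mono le_rfl
      fun _ hr => hr.congr (by ring)) ?_
  omega

/-- An upper bound for the number of steps of `toomCook k`. -/
def toomCookCost : ℕ → ℕ
  | 0 => 1
  | k + 1 => 5 * toomCookCost k + 80 * 3 ^ k + 20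

lemma runs_toomCook_zero {p q : ℝ[X]} {as bs : List ℝ} (ha : Represents p 1 as)
    (hb : Represents q 1 bs) : Runs (toomCook 0 as bs) 1 (Represents (p * q) 2) := by
  obtain ⟨rfl, ha⟩ := ha
  obtain ⟨rfl, hb⟩ := hb
  match as, bs, ha, hb with
  | [], _, _, _ => exact (Runs.pure ⟨by simp [ofCoeffs], by simp⟩).trans_le (Nat.zero_le _)
  | [_], [], _, _ => exact (Runs.pure ⟨by simp [ofCoeffs], by simp⟩).trans_le (Nat.zero_le _)
  | [a], [b], _, _ =>
    exact Runs.bind (runs_mul a b) fun t ht => Runs.pure ⟨by simp [ofCoeffs, ht], by simp⟩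

lemma runs_toomCook_succ {k T : ℕ}
    (ih : ∀ {p q : ℝ[X]} {as bs : List ℝ}, Represents p (3 ^ k) as → Represents q (3 ^ k) bs →
      Runs (toomCook k as bs) T (Represents (p * q) (2 * 3 ^ k)))
    {p q : ℝ[X]} {as bs : List ℝ} (ha : Represents p (3 * 3 ^ k) as)
    (hb : Represents q (3 * 3 ^ k) bs) :
    Runs (toomCook (k + 1) as bs) (5 * T + 80 * 3 ^ k + 20)
      (Represents (p * q) (6 * 3 ^ k)) := by
  match as, bs with
  | [], _ =>
    exact (Runs.pure ⟨by simp [ofCoeffs, ← ha.1], by simp⟩).trans_le (Nat.zero_le _)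
  | _ :: _, [] =>
    exact (Runs.pure ⟨by simp [ofCoeffs, ← hb.1], by simp⟩).trans_le (Nat.zero_le _)
  | _ :: _, _ :: _ =>
    obtain ⟨p₀, p₁, p₂, rfl, ha₀, ha₁, ha₂⟩ := ha.exists_three_parts
    obtain ⟨q₀, q₁, q₂, rfl, hb₀, hb₁, hb₂⟩ := hb.exists_three_parts
    have C2 : (C 2 : ℝ[X]) = 2 := map_ofNat C 2
    have C4 : (C 4 : ℝ[X]) = 4 := map_ofNat C 4
    refine Runs.trans_le (
      Runs.bind (runs_int 2) fun two htwo => Runs.bind (runs_int 3) fun three hthree =>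
      Runs.bind (runs_int 4) fun four hfour => Runs.bind (runs_int 16) fun sixteen hsixteen => by
      rw [Int.cast_ofNat] at htwo hthree hfour hsixteen
      subst htwo hthree hfour hsixteen
      exact
      Runs.bind (runs_addL ha₀ ha₂) fun _ hea =>
      Runs.bind (runs_addL hb₀ hb₂) fun _ heb =>
      Runs.bind (runs_addL hea ha₁) fun _ hap =>
      Runs.bind (runs_addL heb hb₁) fun _ hbp =>
      Runs.bind (runs_subL hea ha₁) fun _ ham =>
      Runs.bind (runs_subL heb hb₁) fun _ hbm =>
      Runs.bind (runs_scaleL_represents _ ha₁) fun _ ha₁' =>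
      Runs.bind (runs_scaleL_represents _ ha₂) fun _ ha₂' =>
      Runs.bind (runs_scaleL_represents _ hb₁) fun _ hb₁' =>
      Runs.bind (runs_scaleL_represents _ hb₂) fun _ hb₂' =>
      Runs.bind (runs_addL ha₁' ha₂') fun _ ha₁₂ =>
      Runs.bind (runs_addL hb₁' hb₂') fun _ hb₁₂ =>
      Runs.bind (runs_addL ha₀ ha₁₂) fun _ hat =>
      Runs.bind (runs_addL hb₀ hb₁₂) fun _ hbt =>
      Runs.bind (ih ha₀ hb₀) fun _ h₀ =>
      Runs.bind (ih hap hbp) fun _ hp =>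
      Runs.bind (ih ham hbm) fun _ hm =>
      Runs.bind (ih hat hbt) fun _ ht =>
      Runs.bind (ih ha₂ hb₂) fun _ h₄ =>
      (runs_toomCookInterpolate (c₁ := p₀ * q₁ + p₁ * q₀) (c₂ := p₀ * q₂ + p₁ * q₁ + p₂ * q₀)
        (c₃ := p₁ * q₂ + p₂ * q₁) h₀ (hp.congr (by ring)) (hm.congr (by ring))
        (ht.congr (by rw [C2, C4]; ring)) h₄).mono le_rfl fun _ hr => hr.congr (by ring)) ?_
    omega

lemma runs_toomCook (k : ℕ) {p q : ℝ[X]} {as bs : List ℝ} (ha : Represents p (3 ^ k) as)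
    (hb : Represents q (3 ^ k) bs) :
    Runs (toomCook k as bs) (toomCookCost k) (Represents (p * q) (2 * 3 ^ k)) := by
  induction k generalizing p q as bs with
  | zero => exact runs_toomCook_zero ha hb
  | succ k ih =>
    rw [pow_succ'] at ha hb ⊢
    rw [← mul_assoc]
    exact runs_toomCook_succ ih ha hb

lemma toomCookCost_le (k : ℕ) : toomCookCost k + 40 * 3 ^ k + 5 ≤ 46 * 5 ^ k := by
  induction k with
  | zero => simp [toomCookCost]
  | succ k ih =>
    rw [toomCookCost, pow_succ, pow_succ]
    linarith

lemma toomCookCost_mono : Monotone toomCookCost :=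
  monotone_nat_of_le_succ fun k => by rw [toomCookCost]; omega

lemma coeff_ofCoeffs_mul_eq_zero {as bs : List ℝ} {i : ℕ} (hi : as.length + bs.length ≤ i + 1) :
    (ofCoeffs as * ofCoeffs bs).coeff i = 0 := by
  rw [coeff_mul]
  refine Finset.sum_eq_zero fun x hx => ?_
  rw [Finset.HasAntidiagonal.mem_antidiagonal] at hx
  rcases le_or_gt as.length x.1 with h | h
  · rw [coeff_ofCoeffs_of_length_le h, zero_mul]
  · rw [coeff_ofCoeffs_of_length_le (i := x.2) (by omega), mul_zero]

lemma runs_mulPoly {p q : ℝ[X]} {L M N : ℕ} {as bs : List ℝ} (ha : Represents p L as)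
    (hb : Represents q M bs) (hL : L ≤ N) (hM : M ≤ N) :
    Runs (mulPoly as bs) (toomCookCost (Nat.clog 3 N)) (Represents (p * q) (L + M - 1)) := by
  obtain ⟨rfl, ha⟩ := ha
  obtain ⟨rfl, hb⟩ := hb
  set k := Nat.clog 3 (max as.length bs.length)
  have hpow : max as.length bs.length ≤ 3 ^ k := Nat.le_pow_clog (by norm_num) _
  have hkN : k ≤ Nat.clog 3 N := Nat.clog_mono_right 3 (max_le (ha.trans hL) (hb.trans hM))
  refine (Runs.bind (runs_toomCook k ⟨rfl, (le_max_left _ _).trans hpow⟩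
    ⟨rfl, (le_max_right _ _).trans hpow⟩) fun r hr => Runs.pure ⟨?_, ?_⟩).trans_le
    (toomCookCost_mono hkN)
  · rw [ofCoeffs_take_of_coeff_eq_zero, hr.1]
    intro i hi
    rw [hr.1, coeff_ofCoeffs_mul_eq_zero (by omega)]
  · exact (List.length_take_le _ _).trans (by omega)

/-! ## Fast interpolation -/

/-- The bound of `runs_combine` for the cost of `combine s`. -/
def combineCost : ℕ → ℕ
  | 0 => 3
  | s + 1 => 2 * combineCost s + 3 * toomCookCost (Nat.clog 3 (2 ^ s + 1)) + 2 ^ (s + 1)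

/-- The result `r` of `combine` on the pairs `l`: the first list stands for the nodal polynomial,
the second one for the Lagrange sum. -/
def RepresentsLagrange (l : List (ℝ × ℝ)) (r : List ℝ × List ℝ) : Prop :=
  Represents (nodal (l.map Prod.fst)) (l.length + 1) r.1 ∧
    Represents (lagrangeSum l) l.length r.2

lemma runs_combine_nil (s : ℕ) : Runs (combine s []) 1 (RepresentsLagrange []) := by
  have h : combine s ([] : List (ℝ × ℝ)) = (int 1 >>= fun one => pure ([one], [])) := by
    cases s <;> rfl
  rw [h]
  exact Runs.bind (T₂ := 0) (runs_int 1) fun one hone => Runs.pure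
    ⟨⟨by simp [ofCoeffs, nodal, hone], by simp⟩, ⟨rfl, by simp⟩⟩

lemma runs_combine_singleton (a : ℝ × ℝ) :
    Runs (combine 0 [a]) 3 (RepresentsLagrange [a]) :=
  Runs.bind (T₂ := 2) (runs_int 0) fun z hz => Runs.bind (T₂ := 1) (runs_sub z a.1) fun y hy =>
    Runs.bind (T₂ := 0) (runs_int 1) fun one hone => Runs.pure
      ⟨⟨by simp [ofCoeffs, nodal, hone, hy, hz, neg_add_eq_sub], by simp⟩,
        ⟨by simp [ofCoeffs, lagrangeSum, nodal], by simp⟩⟩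

lemma runs_combine_succ {s : ℕ} {l : List (ℝ × ℝ)} (hl : l.length ≤ 2 ^ (s + 1)) (hne : l ≠ [])
    (ih : ∀ l' : List (ℝ × ℝ), l'.length ≤ 2 ^ s →
      Runs (combine s l') (combineCost s) (RepresentsLagrange l')) :
    Runs (combine (s + 1) l) (combineCost (s + 1)) (RepresentsLagrange l) := by
  obtain ⟨a, t, rfl⟩ := List.exists_cons_of_ne_nil hne
  rw [combine]
  generalize a :: t = l at hl ⊢
  rw [pow_succ'] at hl
  have hsplit : l.take (2 ^ s) ++ l.drop (2 ^ s) = l := List.take_append_drop _ _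
  have h₁ : (l.take (2 ^ s)).length ≤ 2 ^ s := List.length_take_le _ _
  have h₂ : (l.drop (2 ^ s)).length ≤ 2 ^ s := by rw [List.length_drop]; omega
  generalize l.take (2 ^ s) = l₁ at *
  generalize l.drop (2 ^ s) = l₂ at *
  subst hsplit
  unfold RepresentsLagrange
  rw [List.map_append, nodal_append, lagrangeSum_append, List.length_append]
  refine (Runs.bind (ih l₁ h₁) fun r₁ hr₁ => Runs.bind (ih l₂ h₂) fun r₂ hr₂ =>
    Runs.bind (runs_mulPoly (N := 2 ^ s + 1) hr₁.1 hr₂.1 (by omega) (by omega)) fun M hM =>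
    Runs.bind (runs_mulPoly (N := 2 ^ s + 1) hr₁.2 hr₂.1 (by omega) (by omega)) fun F₁ hF₁ =>
    Runs.bind (runs_mulPoly (N := 2 ^ s + 1) hr₂.2 hr₁.1 (by omega) (by omega)) fun F₂ hF₂ =>
    Runs.bind (runs_addL (L := l₁.length + l₂.length) (hF₁.mono (by omega)) (hF₂.mono (by omega)))
      fun F hF => Runs.pure ⟨hM.mono (by omega), hF⟩).trans_le ?_
  rw [combineCost, pow_succ']
  omega

lemma one_le_combineCost (s : ℕ) : 1 ≤ combineCost s := by
  cases s with
  | zero => simp [combineCost]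
  | succ s => exact Nat.one_le_two_pow.trans (Nat.le_add_left _ _)

lemma runs_combine {s : ℕ} {l : List (ℝ × ℝ)} (hl : l.length ≤ 2 ^ s) :
    Runs (combine s l) (combineCost s) (RepresentsLagrange l) := by
  induction s generalizing l with
  | zero =>
    rcases l with _ | ⟨a, _ | _⟩
    · exact (runs_combine_nil 0).trans_le (one_le_combineCost 0)
    · exact runs_combine_singleton a
    · simp at hl
  | succ s ih =>
    rcases eq_or_ne l [] with rfl | hne
    · exact (runs_combine_nil _).trans_le (one_le_combineCost _)
    · exact runs_combine_succ hl hne fun _ hl' => ih hl'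

section NodeWeights

variable {K : Type} [Field K] [DecidableEq K]

lemma runs_prodDiff (x : K) (l : List K) :
    Runs (prodDiff x l) (1 + 2 * l.length) (· = (l.map fun y => x - y).prod) := by
  induction l with
  | nil => exact (runs_int 1).mono le_rfl (by simp)
  | cons y l ih =>
    refine (Runs.bind (runs_sub x y) fun t ht => Runs.bind ih fun r hr =>
      (runs_mul t r).mono le_rfl fun w hw => ?_).trans_le (by rw [List.length_cons]; omega)
    simp [hw, ht, hr]

lemma runs_nodeWeights (pre post : List K) (h : (pre ++ post).Nodup) :
    Runs (nodeWeights pre post) (post.length * (1 + 2 * (pre ++ post).length))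
      (· = post.map (nodeWeight (pre ++ post))) := by
  induction post generalizing pre with
  | nil =>
    rw [List.length_nil, zero_mul]
    exact Runs.pure rfl
  | cons x post ih =>
    have happ : pre ++ [x] ++ post = pre ++ x :: post := by simp
    have hx : x ∉ pre := fun hx => (List.nodup_append.1 h).2.2 x hx x (by simp) rfl
    have herase : (pre ++ x :: post).erase x = pre ++ post := by
      rw [List.erase_append_right _ hx, List.erase_cons_head]
    have hpost := ih (pre ++ [x]) (by rwa [happ])
    rw [happ] at hpost
    refine (Runs.bind (runs_prodDiff x (pre ++ post)) fun w hw => Runs.bind hpost fun ws hws =>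
      Runs.pure ?_).trans_le ?_
    · rw [hw, hws, List.map_cons, nodeWeight, herase]
    · simp only [List.length_append, List.length_cons]
      nlinarith

end NodeWeights

lemma runs_interpolate {xs : List ℝ} (h : xs.Nodup) {Q : ℝ[X]} (hQ : Q.degree < xs.length) :
    Runs (interpolate xs (xs.map (nodeWeight xs)) (xs.map fun x => Q.eval x))
      (xs.length + combineCost (Nat.clog 2 xs.length)) fun r => ofCoeffs r = Q := by
  have hvalues : (xs.map fun x => Q.eval x).zip (xs.map (nodeWeight xs))
      = xs.map fun x => (Q.eval x, nodeWeight xs x) := List.zip_map'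
  have hnodes : xs.zip (xs.map fun x => Q.eval x / nodeWeight xs x)
      = xs.map fun x => (x, Q.eval x / nodeWeight xs x) := by
    simpa using List.zip_map' (f := id) (g := fun x => Q.eval x / nodeWeight xs x) (l := xs)
  rw [interpolate, hvalues]
  refine (Runs.bind (runs_mapList (T := 1) (fun a => a.1 / a.2) _ fun a ha => ?_) fun us hus =>
    Runs.bind (T₂ := 0) (runs_combine (s := Nat.clog 2 xs.length) ?_) fun r hr =>
      Runs.pure ?_).trans_le (by simp)
  · obtain ⟨x, -, rfl⟩ := List.mem_map.1 ha
    exact runs_div (nodeWeight_ne_zero h x)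
  · rw [List.length_zip]
    exact (min_le_left _ _).trans (Nat.le_pow_clog (by norm_num) _)
  · rw [hr.2.1, hus, List.map_map]
    exact (congrArg lagrangeSum hnodes).trans (lagrangeSum_eval_div_nodeWeight h hQ)

lemma pow_clog_le {b N : ℕ} (hb : 1 < b) (hN : 1 < N) : b ^ Nat.clog b N ≤ b * (N - 1) := by
  obtain ⟨k, hk⟩ := Nat.exists_eq_succ_of_ne_zero (Nat.clog_pos hb hN).ne'
  have h := Nat.pow_pred_clog_lt_self hb hN
  rw [hk, Nat.pred_succ] at h
  rw [hk, Nat.pow_succ']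
  exact Nat.mul_le_mul_left b (by omega)

/-- The constant works because `5 ^ 2 < 3 ^ 3`, so that `5 ^ (log₃ N) ≤ N ^ (3 / 2)`. -/
lemma five_pow_clog_sq_le (s : ℕ) : (5 ^ Nat.clog 3 (2 ^ s + 1)) ^ 2 ≤ 27 * 8 ^ s := by
  have h := pow_clog_le (b := 3) (N := 2 ^ s + 1) (by norm_num) (by simp)
  rw [Nat.add_sub_cancel] at h
  calc (5 ^ Nat.clog 3 (2 ^ s + 1)) ^ 2 = 25 ^ Nat.clog 3 (2 ^ s + 1) := by
        rw [pow_right_comm]; norm_num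
    _ ≤ 27 ^ Nat.clog 3 (2 ^ s + 1) := Nat.pow_le_pow_left (by norm_num) _
    _ = (3 ^ Nat.clog 3 (2 ^ s + 1)) ^ 3 := by rw [pow_right_comm]; norm_num
    _ ≤ (3 * 2 ^ s) ^ 3 := Nat.pow_le_pow_left h 3
    _ = 27 * 8 ^ s := by rw [mul_pow, pow_right_comm]; norm_num

lemma combineCost_sq_le (s : ℕ) : combineCost s ^ 2 ≤ 771282 * 8 ^ s := by
  induction s with
  | zero => norm_num [combineCost]
  | succ s ih =>
    set w := 3 * toomCookCost (Nat.clog 3 (2 ^ s + 1)) + 2 ^ (s + 1) with hw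
    have hw_le : w ≤ 138 * 5 ^ Nat.clog 3 (2 ^ s + 1) := by
      have htoom := toomCookCost_le (Nat.clog 3 (2 ^ s + 1))
      have hpow := Nat.le_pow_clog (b := 3) (by norm_num) (2 ^ s + 1)
      rw [hw, pow_succ']
      omega
    have hw_sq : w ^ 2 ≤ 514188 * 8 ^ s := by
      have h := Nat.pow_le_pow_left hw_le 2
      rw [mul_pow] at h
      linarith [five_pow_clog_sq_le s]
    -- `2` is less than the square root of `8`: `(2T + w)² ≤ 6T² + 3w²`
    calc combineCost (s + 1) ^ 2 = (2 * combineCost s + w) ^ 2 := by rw [combineCost, hw, add_assoc]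
      _ ≤ 6 * combineCost s ^ 2 + 3 * w ^ 2 := by linarith [two_mul_le_add_sq (combineCost s) w]
      _ ≤ 771282 * 8 ^ (s + 1) := by rw [pow_succ 8]; linarith

lemma combineCost_clog_sq_le {N : ℕ} (hN : 1 < N) :
    combineCost (Nat.clog 2 N) ^ 2 ≤ 771282 * (2 * N) ^ 3 := by
  have hpow : 2 ^ Nat.clog 2 N ≤ 2 * N :=
    (pow_clog_le (by norm_num) hN).trans (Nat.mul_le_mul_left 2 (Nat.sub_le N 1))
  calc combineCost (Nat.clog 2 N) ^ 2 ≤ 771282 * 8 ^ Nat.clog 2 N := combineCost_sq_le _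
    _ = 771282 * (2 ^ Nat.clog 2 N) ^ 3 := by rw [pow_right_comm]; norm_num
    _ ≤ 771282 * (2 * N) ^ 3 := Nat.mul_le_mul_left _ (Nat.pow_le_pow_left hpow 3)

/-! ## The signed Euclidean algorithm -/

lemma runs_derivFrom (k : ℕ) (l : List ℝ) : Runs (derivFrom k l) (2 * l.length) fun r =>
    ofCoeffs r = C (k : ℝ) * ofCoeffs l + X * derivative (ofCoeffs l) ∧ r.length = l.length := by
  induction l generalizing k with
  | nil => exact Runs.pure ⟨by simp [ofCoeffs], rfl⟩
  | cons a l ih =>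
    refine (Runs.bind (runs_int k) fun c hc => Runs.bind (runs_mul c a) fun t ht =>
      Runs.bind (ih (k + 1)) fun r hr => Runs.pure ⟨?_, by simp [hr.2]⟩).trans_le
      (by rw [List.length_cons]; omega)
    simp only [ofCoeffs, ht, hc, hr.1, derivative_add, derivative_C, derivative_mul, derivative_X,
      C_mul, Nat.cast_add, Nat.cast_one, C_add, C_1, Int.cast_natCast]
    ring

lemma runs_derivFrom_tail {p : List ℝ} {m : ℕ} (hp : p.length = m + 1) :
    Runs (derivFrom 1 p.tail) (2 * m) fun r =>
      ofCoeffs r = derivative (ofCoeffs p) ∧ r.length = m := by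
  obtain ⟨a, l, rfl⟩ := List.exists_cons_of_length_eq_add_one hp
  obtain rfl : l.length = m := by simpa using hp
  exact (runs_derivFrom 1 l).mono le_rfl fun r hr => ⟨by simp [hr.1, ofCoeffs], hr.2⟩

lemma runs_subScaled (x : ℝ) {as bs : List ℝ} (h : bs.length ≤ as.length) :
    Runs (subScaled x as bs) (2 * bs.length) fun r =>
      ofCoeffs r = ofCoeffs as - C x * ofCoeffs bs ∧ r.length = as.length := by
  induction as generalizing bs with
  | nil =>
    obtain rfl : bs = [] := by simpa using h
    exact Runs.pure ⟨by simp [ofCoeffs], rfl⟩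
  | cons a as ih =>
    cases bs with
    | nil => exact Runs.pure ⟨by simp [ofCoeffs], rfl⟩
    | cons b bs =>
      refine (Runs.bind (runs_mul x b) fun t ht => Runs.bind (runs_sub a t) fun s hs =>
        Runs.bind (ih (by simpa using h)) fun r hr => Runs.pure ⟨?_, by simp [hr.2]⟩).trans_le
        (by rw [List.length_cons]; omega)
      simp only [ofCoeffs, hs, ht, hr.1, C_sub, C_mul]
      ring

lemma runs_remLoop {b : ℝ} (hb : b ≠ 0) (bs : List ℝ) {s : ℕ} {A : List ℝ}
    (h : bs.length + s ≤ A.length) :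
    Runs (remLoop b bs s A) (s * (1 + 2 * bs.length)) fun r =>
      r.length = A.length - s ∧ ∃ u : ℝ[X], (∀ i, s ≤ i → u.coeff i = 0) ∧
        ofCoeffs A = u * ofCoeffs (b :: bs) + X ^ s * ofCoeffs r := by
  induction s generalizing A with
  | zero => exact (Runs.pure ⟨rfl, 0, by simp, by simp⟩).trans_le (Nat.zero_le _)
  | succ s ih =>
    rcases A with _ | ⟨a, as⟩
    · simp at h
    rw [List.length_cons] at h
    refine (Runs.bind (runs_div (x := a) hb) fun x hx =>
      Runs.bind (runs_subScaled x (by omega)) fun as' has' =>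
      (ih (A := as') (by omega)).mono le_rfl ?_).trans_le (by linarith)
    rintro r ⟨hlen, u, hu, hdiv⟩
    refine ⟨by rw [List.length_cons]; omega, C x + X * u, ?_, ?_⟩
    · rintro (_ | i) hi
      · omega
      · rw [coeff_add, coeff_C_succ, coeff_X_mul, hu i (by omega), add_zero]
    · have hlead : C a = C x * C b := by rw [← C_mul, hx, div_mul_cancel₀ _ hb]
      have htail : ofCoeffs as
          = u * ofCoeffs (b :: bs) + X ^ s * ofCoeffs r + C x * ofCoeffs bs := by
        rw [← hdiv, has'.1, sub_add_cancel]
      rw [ofCoeffs, htail, hlead]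
      simp only [ofCoeffs]
      ring

lemma runs_stripZeros (l : List ℝ) : Runs (stripZeros l) l.length fun r =>
    r.length ≤ l.length ∧ ofCoeffs l = X ^ (l.length - r.length) * ofCoeffs r ∧
      ∀ b ∈ r.head?, b ≠ 0 := by
  induction l with
  | nil => exact Runs.pure ⟨le_rfl, by simp, by simp⟩
  | cons a l ih =>
    rw [List.length_cons, add_comm]
    refine Runs.bind (runs_isZero a) fun z hz => ?_
    cases z with
    | true =>
      refine ih.mono le_rfl fun r ⟨hlen, hl, hhead⟩ => ⟨Nat.le_add_left_of_le hlen, ?_, hhead⟩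
      rw [ofCoeffs, hz.1 rfl, C_0, zero_add, hl, ← mul_assoc, ← pow_succ',
        show 1 + l.length - r.length = l.length - r.length + 1 by omega]
    | false =>
      have ha : a ≠ 0 := fun h => by simpa using hz.2 h
      exact (Runs.pure ⟨by simp [add_comm], by simp [add_comm], by simpa using ha⟩).trans_le
        (Nat.zero_le _)

/-- The list `R` stands for the negative of a remainder in the division of `A` by `B`, where the
lists contain the coefficients of polynomials with the leading coefficient first. On these reversed
polynomials, the condition that the remainder has small degree says that `ofCoeffs R` occurs with
a large power of `X`. -/
def IsNegRemainder (A B R : List ℝ) : Prop :=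
  R.length < B.length ∧ ∃ u : ℝ[X], u.natDegree ≤ A.length - B.length ∧
    ofCoeffs A = u * ofCoeffs B - X ^ (A.length - R.length) * ofCoeffs R

/-- The `j`-th subresultant of two polynomials given by their coefficients, leading coefficients
first. -/
noncomputable def listSRes (A B : List ℝ) (j : ℕ) : ℝ :=
  if j < B.length then
    subdet (A.length + B.length - 2 - 2 * j) (B.length - 1 - j)
      (ofCoeffs A : PowerSeries ℝ) (ofCoeffs B : PowerSeries ℝ)
  else 0

lemma coeff_zero_ofCoeffs_cons (b : ℝ) (bs : List ℝ) :
    PowerSeries.coeff 0 (ofCoeffs (b :: bs) : PowerSeries ℝ) = b := by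
  rw [Polynomial.coeff_coe, coeff_ofCoeffs]
  rfl

lemma listSRes_of_length_le {A B : List ℝ} {j : ℕ} (h : B.length ≤ j) : listSRes A B j = 0 :=
  if_neg h.not_gt

lemma listSRes_length {A : List ℝ} {b : ℝ} {bs : List ℝ} :
    listSRes A (b :: bs) bs.length
      = revSign ℝ (A.length - (bs.length + 1)) * b ^ (A.length - (bs.length + 1)) := by
  rw [listSRes, if_pos (by simp), List.length_cons, Nat.add_sub_cancel, Nat.sub_self, subdet_zero,
    coeff_zero_ofCoeffs_cons,
    show A.length + (bs.length + 1) - 2 - 2 * bs.length = A.length - (bs.length + 1) by omega]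

lemma IsNegRemainder.listSRes_eq {A bs R : List ℝ} {b : ℝ} {j : ℕ}
    (h : IsNegRemainder A (b :: bs) R) (hA : bs.length < A.length) (hj : j < bs.length) :
    listSRes A (b :: bs) j = revSign ℝ (A.length - (bs.length + 1)) * b ^ (A.length - R.length)
      * listSRes (b :: bs) R j := by
  obtain ⟨hR, u, hu, hdiv⟩ := h
  rw [List.length_cons] at hR hu
  obtain ⟨δ, hδ⟩ : ∃ δ, A.length = bs.length + 1 + δ := Nat.exists_eq_add_of_le hA
  obtain ⟨a, ha⟩ := Nat.exists_eq_add_of_le hj.le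
  obtain ⟨e, he⟩ : ∃ e, A.length = R.length + e := Nat.exists_eq_add_of_le (by omega)
  have hseries : (ofCoeffs A : PowerSeries ℝ)
      = (u : PowerSeries ℝ) * (ofCoeffs (b :: bs) : PowerSeries ℝ)
        - PowerSeries.X ^ (A.length - R.length) * (ofCoeffs R : PowerSeries ℝ) := by
    rw [hdiv]
    push_cast
    rfl
  rw [show A.length - (bs.length + 1) = δ by omega] at hu ⊢
  rw [show A.length - R.length = e by omega] at hseries ⊢
  rw [listSRes, if_pos (by rw [List.length_cons]; omega), List.length_cons,
    show A.length + (bs.length + 1) - 2 - 2 * j = a + a + δ by omega,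
    show bs.length + 1 - 1 - j = a by omega, subdet_eq_of_eq_mul_sub hu hseries, mul_assoc]
  congr 1
  rcases lt_or_ge j R.length with hjR | hjR
  · rw [listSRes, if_pos hjR, List.length_cons,
      show a + a + δ = bs.length + 1 + R.length - 2 - 2 * j + e by omega,
      show a + δ = R.length - 1 - j + e by omega, subdet_X_pow_mul, coeff_zero_ofCoeffs_cons]
  · rw [listSRes_of_length_le hjR, mul_zero]
    exact subdet_X_pow_mul_eq_zero (by omega) (by omega) _ _

/-- The result of the program `sResLoop`: the subresultants of `A` and `B`, multiplied by `μ`, from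
the highest index to `0`. -/
noncomputable def sResList (μ : ℝ) (A B : List ℝ) : List ℝ :=
  ((List.range (A.length - 1)).map fun j => μ * listSRes A B j).reverse

lemma sResList_nil (μ : ℝ) (A : List ℝ) : sResList μ A [] = List.replicate (A.length - 1) 0 := by
  simp [sResList, listSRes]

lemma map_range_eq_append_replicate {α : Type*} {F : ℕ → α} {a : α} {q : ℕ} (k : ℕ)
    (h : ∀ i, q < i → F i = a) :
    (List.range (q + 1 + k)).map F = (List.range q).map F ++ F q :: List.replicate k a := by
  have hconst : (List.range k).map (F ∘ fun i => q + 1 + i) = List.replicate k a :=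
    (List.map_congr_left fun i _ => h (q + 1 + i) (by omega)).trans (by simp)
  rw [List.range_add, List.range_succ, List.map_append, List.map_append, List.map_map, hconst,
    List.append_assoc]
  rfl

lemma IsNegRemainder.sResList_eq {A bs R : List ℝ} {b : ℝ} (μ : ℝ)
    (h : IsNegRemainder A (b :: bs) R) (hA : bs.length + 1 < A.length) :
    sResList μ A (b :: bs) = List.replicate (A.length - (bs.length + 1) - 1) 0 ++
      μ * revSign ℝ (A.length - (bs.length + 1)) * b ^ (A.length - (bs.length + 1)) ::
        sResList (μ * revSign ℝ (A.length - (bs.length + 1)) * b ^ (A.length - R.length))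
          (b :: bs) R := by
  have hvanish (i : ℕ) (hi : bs.length < i) : μ * listSRes A (b :: bs) i = 0 := by
    rw [listSRes_of_length_le hi, mul_zero]
  rw [sResList, show A.length - 1 = bs.length + 1 + (A.length - (bs.length + 1) - 1) by omega,
    map_range_eq_append_replicate _ hvanish, List.reverse_append, List.reverse_cons,
    List.reverse_replicate, List.append_assoc, List.singleton_append, listSRes_length, sResList,
    List.length_cons, Nat.add_sub_cancel, ← mul_assoc]
  congr 3
  refine List.map_congr_left fun j hj => ?_
  rw [h.listSRes_eq (by omega) (List.mem_range.1 hj)]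
  ring

lemma sResLoop_cost_le {L a q δ : ℕ} (ha : a = q + 1 + δ) (hL : a ≤ L) :
    (δ + 1) * (1 + 2 * q) + δ + 2 * q + a + 10 + (5 * L + 7) * (2 * q + 1)
      ≤ (5 * L + 7) * (a + (q + 1)) := by
  have h : (δ + 1) * (1 + 2 * q) ≤ (δ + 1) * (2 * L) := Nat.mul_le_mul_left _ (by omega)
  subst ha
  nlinarith [h]

lemma runs_sResLoop_succ {L f : ℕ} {μ b : ℝ} {A bs : List ℝ} (hb : b ≠ 0)
    (hA : bs.length + 1 < A.length) (hL : A.length ≤ L)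
    (ih : ∀ (μ' : ℝ) (R : List ℝ), R.length ≤ bs.length → (∀ c ∈ R.head?, c ≠ 0) →
      Runs (sResLoop f μ' (b :: bs) R) ((5 * L + 7) * (bs.length + 1 + R.length) + 1)
        (· = sResList μ' (b :: bs) R)) :
    Runs (sResLoop (f + 1) μ A (b :: bs)) ((5 * L + 7) * (A.length + (bs.length + 1)) + 1)
      (· = sResList μ A (b :: bs)) := by
  rw [sResLoop]
  set δ := A.length - (bs.length + 1) with hδ
  refine (Runs.bind (runs_int _) fun ε hε => Runs.bind (runs_mul μ ε) fun ν hν =>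
    Runs.bind (runs_pow b δ) fun y hy => Runs.bind (runs_mul ν y) fun s hs =>
    Runs.bind (runs_zeros (δ - 1)) fun z hz =>
    Runs.bind (runs_remLoop hb bs (by omega)) fun R₀ hR₀ =>
    Runs.bind ((runs_negL R₀).trans_le (T' := 1 + bs.length) (by omega)) fun R₁ hR₁ =>
    Runs.bind (T₂ := A.length + 2 + ((5 * L + 7) * (2 * bs.length + 1) + 1))
      ((runs_stripZeros R₁).trans_le (T' := bs.length) (by rw [hR₁, List.length_map]; omega))
      fun R hR => ?_).trans_le ?_
  · obtain ⟨hlen₀, u, hu, hdiv⟩ := hR₀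
    obtain ⟨hlen, hstrip, hhead⟩ := hR
    have hlen₁ : R₁.length = bs.length := by rw [hR₁, List.length_map]; omega
    have hrem : IsNegRemainder A (b :: bs) R := by
      refine ⟨by rw [List.length_cons]; omega, u, ?_, ?_⟩
      · exact natDegree_le_iff_coeff_eq_zero.2 fun i hi => hu i hi
      · have hneg : ofCoeffs R₀ = -ofCoeffs R₁ := by rw [hR₁, ofCoeffs_map_neg, neg_neg]
        rw [hdiv, hneg, hstrip,
          show A.length - R.length = δ + 1 + (R₁.length - R.length) by omega, pow_add]
        ring
    have hsign : ε = revSign ℝ δ := by rw [hε, revSign]; push_cast; rfl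
    refine (Runs.bind (runs_pow b _) fun w hw => Runs.bind (runs_mul ν w) fun μ' hμ' =>
      Runs.bind (T₂ := 0) ((ih μ' R (by omega) hhead).trans_le
        (T' := (5 * L + 7) * (2 * bs.length + 1) + 1) ?_) fun rest hrest =>
          Runs.pure ?_).trans_le (by omega)
    · exact Nat.add_le_add_right (Nat.mul_le_mul_left _ (by omega)) 1
    · rw [hrem.sResList_eq μ hA, hz, hrest, hs, hμ', hν, hsign, hy, hw]
  · have := sResLoop_cost_le (show A.length = bs.length + 1 + δ by rw [hδ]; omega) hL
    omega

lemma runs_sResLoop {L f : ℕ} (μ : ℝ) {A B : List ℝ} (hf : B.length ≤ f)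
    (hAB : B.length < A.length) (hL : A.length ≤ L) (hB : ∀ b ∈ B.head?, b ≠ 0) :
    Runs (sResLoop f μ A B) ((5 * L + 7) * (A.length + B.length) + 1) (· = sResList μ A B) := by
  induction f generalizing μ A B with
  | zero =>
    obtain rfl : B = [] := by simpa using hf
    exact (runs_zeros (A.length - 1)).mono (by omega) fun r hr => by rw [hr, sResList_nil]
  | succ f ih =>
    rcases B with _ | ⟨b, bs⟩
    · exact (runs_zeros (A.length - 1)).mono (by omega) fun r hr => by rw [hr, sResList_nil]
    · rw [List.length_cons] at hf hAB
      refine runs_sResLoop_succ (hB b (by simp)) hAB hL fun μ' R hR hhead => ?_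
      exact ih μ' (by omega) (by rw [List.length_cons]; omega) (by rw [List.length_cons]; omega)
        hhead

lemma ofCoeffs_reverse (l : List ℝ) :
    ofCoeffs l.reverse = (ofCoeffs l).reflect (l.length - 1) := by
  ext i
  rw [coeff_reflect, coeff_ofCoeffs, coeff_ofCoeffs]
  rcases lt_or_ge i l.length with h | h
  · rw [revAt_le (by omega), List.getD_reverse _ h]
  · rw [List.getD_eq_default _ _ (by simpa using h)]
    rcases Nat.eq_zero_or_pos l.length with h0 | h0
    · rw [List.length_eq_zero_iff.1 h0, List.getD_nil]
    · rw [revAt_eq_self_of_lt (by omega), List.getD_eq_default _ _ h]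

lemma listSRes_reverse_derivative {p p' : List ℝ} {m : ℕ}
    (hp : p.length = m + 1) (hdeg : (ofCoeffs p).natDegree = m)
    (hp' : ofCoeffs p' = derivative (ofCoeffs p)) (hlen : p'.length = m) {k : ℕ} (hk : k < m) :
    listSRes p.reverse p'.reverse k = sRes k (ofCoeffs p) := by
  rw [listSRes, List.length_reverse, List.length_reverse, hp, hlen, if_pos hk, ofCoeffs_reverse,
    ofCoeffs_reverse, hp, hlen, hp', Nat.add_sub_cancel, sRes_eq_subdet, hdeg,
    show m + 1 + m - 2 - 2 * k = 2 * m - 1 - 2 * k by omega]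

lemma sResList_reverse_derivative {p p' : List ℝ} {m : ℕ}
    (hp : p.length = m + 1) (hdeg : (ofCoeffs p).natDegree = m)
    (hp' : ofCoeffs p' = derivative (ofCoeffs p)) (hlen : p'.length = m) :
    (sResList 1 p.reverse p'.reverse).reverse
      = (List.range m).map fun k => sRes k (ofCoeffs p) := by
  rw [sResList, List.reverse_reverse, List.length_reverse, hp, Nat.add_sub_cancel]
  refine List.map_congr_left fun k hk => ?_
  rw [one_mul, listSRes_reverse_derivative hp hdeg hp' hlen (List.mem_range.1 hk)]

lemma head_reverse_derivative_ne_zero {p p' : List ℝ} {m : ℕ} (hdeg : (ofCoeffs p).natDegree = m)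
    (hp' : ofCoeffs p' = derivative (ofCoeffs p)) (hlen : p'.length = m) :
    ∀ b ∈ p'.reverse.head?, b ≠ 0 := by
  rintro b hb rfl
  rw [List.head?_reverse, List.getLast?_eq_getElem?, hlen, Option.mem_def] at hb
  have hm : m - 1 + 1 = m := by
    have := (List.getElem?_eq_some_iff.1 hb).1
    omega
  have hlast : (ofCoeffs p').coeff (m - 1) = 0 := by
    rw [coeff_ofCoeffs, List.getD_eq_getElem?_getD, hb, Option.getD_some]
  rw [hp', coeff_derivative, hm] at hlast
  rcases mul_eq_zero.1 hlast with hlead | hcast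
  · rw [← hdeg, coeff_natDegree, leadingCoeff_eq_zero] at hlead
    rw [hlead, natDegree_zero] at hdeg
    omega
  · exact absurd hcast (by positivity)

lemma runs_allSRes {p : List ℝ} {m : ℕ} (hp : p.length = m + 1)
    (hdeg : (ofCoeffs p).natDegree = m) :
    Runs (allSRes p) ((5 * m + 12) * (2 * m + 1) + 2 * m + 2)
      (· = (List.range m).map fun k => sRes k (ofCoeffs p)) := by
  refine (Runs.bind (runs_derivFrom_tail hp) fun p' ⟨hp', hlen⟩ => Runs.bind (runs_int 1)
    fun one hone => Runs.bind (T₂ := 0) ((runs_sResLoop (L := m + 1) (A := p.reverse)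
      (B := p'.reverse) one ?_ ?_ ?_ (head_reverse_derivative_ne_zero hdeg hp' hlen)).trans_le
        (T' := (5 * (m + 1) + 7) * (2 * m + 1) + 1) ?_)
      fun l hl => Runs.pure ?_).trans_le (by linarith)
  · simp [hp, hlen]
  · simp [hp, hlen]
  · simp [hp]
  · rw [List.length_reverse, List.length_reverse, hp, hlen, two_mul, add_right_comm]
  · rw [hl, hone, Int.cast_one, sResList_reverse_derivative hp hdeg hp' hlen]

end Prog

/-! ## Subdiscriminants in a polynomial family -/

section Family

variable {R : Type*} [CommRing R]

lemma natDegree_det_le_sum {ι : Type*} [Fintype ι] [DecidableEq ι] {M : Matrix ι ι R[X]}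
    {d : ι → ℕ} (h : ∀ i j, (M i j).natDegree ≤ d j) : M.det.natDegree ≤ ∑ j, d j := by
  rw [Matrix.det_apply]
  refine natDegree_sum_le_of_forall_le _ _ fun σ _ => ?_
  have hprod : (∏ j, M (σ j) j).natDegree ≤ ∑ j, d j :=
    (natDegree_prod_le _ _).trans (Finset.sum_le_sum fun j _ => h _ _)
  rcases Int.units_eq_one_or (Equiv.Perm.sign σ) with hσ | hσ <;> simpa [hσ] using hprod

lemma exists_det_eq_mul_of_column_zero {N d : ℕ} {M : Matrix (Fin (N + 1)) (Fin (N + 1)) R[X]}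
    {a : R[X]} {v : Fin (N + 1) → R} (h0 : ∀ i, M i 0 = a * C (v i))
    (hd : ∀ i j, (M i j).natDegree ≤ d) :
    ∃ E : R[X], E.natDegree ≤ N * d ∧ M.det = a * E := by
  refine ⟨(M.updateCol 0 fun i => C (v i)).det, ?_, ?_⟩
  · refine (natDegree_det_le_sum (d := Fin.cons 0 fun _ => d) fun i j => ?_).trans ?_
    · refine Fin.cases ?_ (fun j => ?_) j
      · simp
      · simpa [Fin.succ_ne_zero] using hd i j.succ
    · simp [Fin.sum_univ_succ]
  · have hcol : (a • fun i => C (v i)) = fun i => M i 0 := funext fun i => (h0 i).symm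
    rw [← Matrix.det_updateCol_smul, hcol, Matrix.updateCol_eq_self]

lemma exists_subdet_eq_mul {d k : ℕ} {f g : PowerSeries R[X]} {b : R}
    (hf : ∀ i, (PowerSeries.coeff i f).natDegree ≤ d)
    (hg : ∀ i, (PowerSeries.coeff i g).natDegree ≤ d)
    (h0 : PowerSeries.coeff 0 g = PowerSeries.coeff 0 f * C b) (N : ℕ) :
    ∃ E : R[X], E.natDegree ≤ N * d ∧ subdet (N + 1) k f g = PowerSeries.coeff 0 f * E := by
  refine exists_det_eq_mul_of_column_zero (v := fun i =>
    if (i : ℕ) < k then (if (i : ℕ) = 0 then 1 else 0) else if (i : ℕ) = N then b else 0) ?_ ?_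
  · intro i
    have hi := i.2
    simp only [subdetMatrix, Matrix.of_apply, Fin.val_zero]
    split_ifs with hik hi0 hiN
    · simp [hi0]
    · simp [hi0]
    · rw [hiN, Nat.add_sub_cancel, Nat.sub_self, pow_zero, one_mul, h0]
    · rw [PowerSeries.coeff_X_pow_mul', if_neg (by omega), C_0, mul_zero]
  · intro i j
    simp only [subdetMatrix, Matrix.of_apply]
    split_ifs <;> rw [PowerSeries.coeff_X_pow_mul'] <;> split_ifs <;> simp [hf, hg]

lemma exists_subdet_reflect_derivative_eq_mul {P : R[X][X]} {d : ℕ}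
    (hd : ∀ i, (P.coeff i).natDegree ≤ d) {m : ℕ} (hm : 0 < m) (k N : ℕ) :
    ∃ E : R[X], E.natDegree ≤ N * d ∧
      subdet (N + 1) k ((P.reflect m : R[X][X]) : PowerSeries R[X])
        ((P.derivative.reflect (m - 1) : R[X][X]) : PowerSeries R[X]) = P.coeff m * E := by
  have hlead : PowerSeries.coeff 0 ((P.reflect m : R[X][X]) : PowerSeries R[X]) = P.coeff m := by
    rw [Polynomial.coeff_coe, coeff_reflect, revAt_le (Nat.zero_le _), Nat.sub_zero]
  rw [← hlead]
  refine exists_subdet_eq_mul (b := (m : R)) (fun i => ?_) (fun i => ?_) ?_ N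
  · rw [Polynomial.coeff_coe, coeff_reflect]
    exact hd _
  · rw [Polynomial.coeff_coe, coeff_reflect, coeff_derivative, ← Nat.cast_add_one, ← map_natCast C]
    exact (natDegree_mul_C_le _ _).trans (hd _)
  · rw [hlead, Polynomial.coeff_coe, coeff_reflect, revAt_le (Nat.zero_le _), Nat.sub_zero,
      coeff_derivative, ← Nat.cast_add_one, Nat.sub_add_cancel hm, map_natCast]

end Family

lemma exists_eval_mul_eq_sRes {P : ℝ[X][X]} {d : ℕ} (hd : ∀ i, (P.coeff i).natDegree ≤ d) {k : ℕ}
    (hk : k < P.natDegree) :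
    ∃ Q : ℝ[X], Q.natDegree ≤ 2 * k * d ∧ ∀ γ, P.leadingCoeff.eval γ ≠ 0 →
      sRes (P.natDegree - (k + 1)) (P.map (evalRingHom γ))
        = P.leadingCoeff.eval γ * Q.eval γ := by
  obtain ⟨Q, hQ, hdet⟩ := exists_subdet_reflect_derivative_eq_mul hd (by omega : 0 < P.natDegree)
    k (2 * k)
  refine ⟨Q, hQ, fun γ hγ => ?_⟩
  rw [sRes_eq_subdet, natDegree_map_of_leadingCoeff_ne_zero (evalRingHom γ) hγ, derivative_map,
    reflect_map, reflect_map, polynomial_map_coe, polynomial_map_coe, ← subdet_map,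
    show 2 * P.natDegree - 1 - 2 * (P.natDegree - (k + 1)) = 2 * k + 1 by omega,
    show P.natDegree - 1 - (P.natDegree - (k + 1)) = k by omega, hdet, ← eval_mul]
  rfl

lemma exists_sDisc_polynomial {P : ℝ[X][X]} {d : ℕ} (hd : ∀ i, (P.coeff i).natDegree ≤ d)
    (k : ℕ) :
    ∃ Q : ℝ[X], Q.natDegree ≤ 2 * k * d ∧ ∀ γ, P.leadingCoeff.eval γ ≠ 0 →
      (Q.eval γ = if k < P.natDegree then
        sRes (P.natDegree - (k + 1)) (P.map (evalRingHom γ)) / P.leadingCoeff.eval γ else 0) ∧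
      ((Q.eval γ : ℝ) : ℂ) = sDisc (k + 1) (P.map (evalRingHom γ)) := by
  rcases lt_or_ge k P.natDegree with hk | hk
  · obtain ⟨Q, hQ, hsRes⟩ := exists_eval_mul_eq_sRes hd hk
    refine ⟨Q, hQ, fun γ hγ => ⟨by rw [if_pos hk, hsRes γ hγ, mul_div_cancel_left₀ _ hγ], ?_⟩⟩
    have hdeg := natDegree_map_of_leadingCoeff_ne_zero (evalRingHom γ) hγ
    have hsDisc := sRes_eq_leadingCoeff_mul_sDisc (hdeg ▸ hk)
    rw [hdeg, leadingCoeff_map_of_leadingCoeff_ne_zero (evalRingHom γ) hγ, hsRes γ hγ,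
      Complex.ofReal_mul] at hsDisc
    exact mul_left_cancel₀ (Complex.ofReal_ne_zero.2 hγ) hsDisc
  · refine ⟨0, by simp, fun γ hγ => ⟨by rw [if_neg hk.not_gt, eval_zero], ?_⟩⟩
    rw [sDisc_eq_zero (by
      rw [natDegree_map_of_leadingCoeff_ne_zero (evalRingHom γ) hγ]; omega), eval_zero,
      Complex.ofReal_zero]

/-- The first `N` coefficients of a polynomial, constant coefficient first. -/
def firstCoeffs {R : Type*} [Semiring R] (N : ℕ) (p : R[X]) : List R := (List.range N).map p.coeff

lemma length_firstCoeffs {R : Type*} [Semiring R] (N : ℕ) (p : R[X]) :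
    (firstCoeffs N p).length = N := by
  rw [firstCoeffs, List.length_map, List.length_range]

lemma firstCoeffs_succ {R : Type*} [Semiring R] (N : ℕ) (p : R[X]) :
    firstCoeffs (N + 1) p = firstCoeffs N p ++ [p.coeff N] := by
  simp [firstCoeffs, List.range_succ]

lemma ofFn_ofFn_coeff {R : Type*} [Semiring R] (M N : ℕ) (P : R[X][X]) :
    (List.ofFn fun k : Fin M => List.ofFn fun j : Fin N => (P.coeff k).coeff j)
      = (firstCoeffs M P).map (firstCoeffs N) :=
  List.ext_getElem (by simp [firstCoeffs]) fun _ _ _ =>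
    List.ext_getElem (by simp [firstCoeffs]) fun _ _ _ => by simp [firstCoeffs]

lemma ofCoeffs_firstCoeffs {p : ℝ[X]} {N : ℕ} (h : p.natDegree < N) :
    ofCoeffs (firstCoeffs N p) = p := by
  ext i
  rw [coeff_ofCoeffs]
  rcases lt_or_ge i N with hi | hi
  · simp [firstCoeffs, hi]
  · rw [List.getD_eq_default _ _ (by rwa [length_firstCoeffs]),
      coeff_eq_zero_of_natDegree_lt (h.trans_le hi)]

lemma map_eval_firstCoeffs (P : ℝ[X][X]) (N : ℕ) (γ : ℝ) :
    (firstCoeffs N P).map (fun a => a.eval γ) = firstCoeffs N (P.map (evalRingHom γ)) := by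
  simp [firstCoeffs, coeff_map]

/-- The family of polynomials with coefficients `c₀, …, cₙ` as a polynomial over `ℝ[γ]`. -/
noncomputable def familyPoly {n : ℕ} (c : Fin (n + 1) → ℝ[X]) : ℝ[X][X] :=
  ∑ k : Fin (n + 1), C (c k) * X ^ (k : ℕ)

lemma map_evalRingHom_familyPoly {n : ℕ} (c : Fin (n + 1) → ℝ[X]) (γ : ℝ) :
    (familyPoly c).map (evalRingHom γ) = member c γ := by
  simp [familyPoly, member, Polynomial.map_sum]

lemma coeff_familyPoly_coe {n : ℕ} (c : Fin (n + 1) → ℝ[X]) (k : Fin (n + 1)) :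
    (familyPoly c).coeff k = c k := by
  simp [familyPoly, Fin.val_inj]

lemma coeff_familyPoly_of_lt {n : ℕ} (c : Fin (n + 1) → ℝ[X]) {i : ℕ} (hi : n < i) :
    (familyPoly c).coeff i = 0 := by
  simp only [familyPoly, finsetSum_coeff, coeff_C_mul_X_pow]
  exact Finset.sum_eq_zero fun k _ => if_neg (by omega)

lemma natDegree_familyPoly {n : ℕ} {c : Fin (n + 1) → ℝ[X]} {m : Fin (n + 1)} (hcm : c m ≠ 0)
    (hc : ∀ k, m < k → c k = 0) : (familyPoly c).natDegree = m := by
  refine natDegree_eq_of_le_of_coeff_ne_zero (natDegree_le_iff_coeff_eq_zero.2 fun i hi => ?_)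
    (by rwa [coeff_familyPoly_coe])
  rcases le_or_gt i n with hin | hin
  · exact (coeff_familyPoly_coe c ⟨i, Nat.lt_succ_of_le hin⟩).trans (hc _ hi)
  · exact coeff_familyPoly_of_lt c hin

lemma natDegree_coeff_familyPoly_le {n d : ℕ} {c : Fin (n + 1) → ℝ[X]}
    (hd : ∀ k, (c k).natDegree ≤ d) (i : ℕ) : ((familyPoly c).coeff i).natDegree ≤ d := by
  rcases le_or_gt i n with hin | hin
  · rw [show (familyPoly c).coeff i = _ from coeff_familyPoly_coe c ⟨i, Nat.lt_succ_of_le hin⟩]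
    exact hd _
  · simp [coeff_familyPoly_of_lt c hin]

namespace Prog

/-! ## Correctness of FastRR -/

lemma runs_trimRows_eq_nil {w : ℕ} {rs : List (List ℝ)} (hw : ∀ r ∈ rs, r.length ≤ w)
    (h0 : ∀ r ∈ rs, ∀ a ∈ r, a = 0) : Runs (trimRows rs) (rs.length * w) (· = []) := by
  induction rs with
  | nil => exact Runs.trans_le (T := 0) (Runs.pure rfl) (Nat.zero_le _)
  | cons r rs ih =>
    rw [List.forall_mem_cons] at hw h0
    rw [List.length_cons, add_one_mul]
    refine Runs.bind (ih hw.2 h0.2) fun rs' hrs' => ?_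
    rw [hrs']
    exact (Runs.bind (T₂ := 0) (runs_allZero r) fun z hz =>
      Runs.pure (if_pos (hz.2 h0.1))).trans_le hw.1

lemma runs_trimRows_append {w : ℕ} {pre post : List (List ℝ)} {r : List ℝ}
    (hw : ∀ s ∈ pre ++ r :: post, s.length ≤ w) (hr : ∃ a ∈ r, a ≠ 0)
    (h0 : ∀ s ∈ post, ∀ a ∈ s, a = 0) :
    Runs (trimRows (pre ++ r :: post)) ((pre ++ r :: post).length * w) (· = pre ++ [r]) := by
  induction pre with
  | nil =>
    rw [List.nil_append, List.forall_mem_cons] at hw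
    rw [List.nil_append, List.length_cons, add_one_mul]
    refine Runs.bind (runs_trimRows_eq_nil hw.2 h0) fun rs' hrs' => ?_
    rw [hrs']
    refine Runs.trans_le (Runs.bind (T₂ := 0) (runs_allZero r) fun z hz => Runs.pure ?_) hw.1
    refine if_neg fun hz' => ?_
    obtain ⟨a, ha, hne⟩ := hr
    exact hne (hz.1 hz' a ha)
  | cons s pre ih =>
    rw [List.cons_append, List.forall_mem_cons] at hw
    refine (Runs.bind (T₂ := 0) (ih hw.2) fun rs' hrs' => ?_).trans_le
      (Nat.mul_le_mul_right _ (by simp))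
    rw [hrs', if_neg (by simp)]
    exact Runs.pure rfl

lemma runs_trimRows {P : ℝ[X][X]} {n d : ℕ} (hP : P ≠ 0) (hn : P.natDegree ≤ n)
    (hd : ∀ i, (P.coeff i).natDegree ≤ d) :
    Runs (trimRows ((firstCoeffs (n + 1) P).map (firstCoeffs (d + 1)))) ((n + 1) * (d + 1))
      (· = (firstCoeffs (P.natDegree + 1) P).map (firstCoeffs (d + 1))) := by
  obtain ⟨e, rfl⟩ := Nat.exists_eq_add_of_le hn
  have hsplit : (firstCoeffs (P.natDegree + e + 1) P).map (firstCoeffs (d + 1))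
      = (firstCoeffs P.natDegree P).map (firstCoeffs (d + 1)) ++
        firstCoeffs (d + 1) P.leadingCoeff ::
          (List.range e).map fun i => firstCoeffs (d + 1) (P.coeff (P.natDegree + (i + 1))) := by
    simp [firstCoeffs, add_assoc, List.range_add, List.range_succ_eq_map, Function.comp_def]
  have hlen : ((firstCoeffs (P.natDegree + e + 1) P).map (firstCoeffs (d + 1))).length
      = P.natDegree + e + 1 := by rw [List.length_map, length_firstCoeffs]
  have h := runs_trimRows_append (w := d + 1)
    (pre := (firstCoeffs P.natDegree P).map (firstCoeffs (d + 1)))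
    (post := (List.range e).map fun i => firstCoeffs (d + 1) (P.coeff (P.natDegree + (i + 1))))
    (r := firstCoeffs (d + 1) P.leadingCoeff)
  rw [← hsplit, hlen] at h
  rw [firstCoeffs_succ P.natDegree, List.map_append, List.map_singleton, coeff_natDegree]
  refine h (fun s hs => ?_) ?_ fun s hs a ha => ?_
  · obtain ⟨p, -, rfl⟩ := List.mem_map.1 hs
    rw [length_firstCoeffs]
  · refine ⟨P.leadingCoeff.leadingCoeff, List.mem_map.2 ⟨P.leadingCoeff.natDegree, ?_, rfl⟩, ?_⟩
    · exact List.mem_range.2 (Nat.lt_succ_of_le (hd _))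
    · simpa using hP
  · obtain ⟨i, -, rfl⟩ := List.mem_map.1 hs
    obtain ⟨j, -, rfl⟩ := List.mem_map.1 ha
    rw [coeff_eq_zero_of_natDegree_lt (by omega : P.natDegree < _), coeff_zero]

open Classical in
lemma runs_goodPoints (top : List ℝ) (js : List ℕ) :
    Runs (goodPoints top js) (js.length * (3 + 2 * top.length))
      (· = ((js.map (Nat.cast : ℕ → ℝ)).filter fun x => (ofCoeffs top).eval x ≠ 0).map
        fun x => (x, (ofCoeffs top).eval x)) := by
  induction js with
  | nil => exact Runs.trans_le (T := 0) (Runs.pure rfl) (Nat.zero_le _)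
  | cons j js ih =>
    refine (Runs.bind (runs_int j) fun x hx => Runs.bind (runs_evalAt top x) fun v hv =>
      Runs.bind (runs_isZero v) fun z hz => Runs.bind ih fun rest hrest =>
        Runs.pure ?_).trans_le (by rw [List.length_cons, add_one_mul]; omega)
    rw [Int.cast_natCast] at hx
    rw [List.map_cons, ← hx]
    by_cases h : (ofCoeffs top).eval x = 0
    · rw [List.filter_cons_of_neg (by simpa using h), hz.2 (hv.trans h), if_pos rfl, hrest]
    · rw [List.filter_cons_of_pos (by simpa using h), List.map_cons,
        if_neg (fun hz' => h (hv ▸ hz.1 hz')), hrest, hv]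

open Classical in
lemma length_le_length_filter_add_natDegree {p : ℝ[X]} (hp : p ≠ 0) {xs : List ℝ}
    (hxs : xs.Nodup) :
    xs.length ≤ (xs.filter fun x => p.eval x ≠ 0).length + p.natDegree := by
  rw [List.length_eq_length_filter_add fun x => decide (p.eval x ≠ 0)]
  refine Nat.add_le_add_left ?_ _
  rw [← List.toFinset_card_of_nodup (hxs.filter _)]
  refine (Finset.card_le_card fun x hx => ?_).trans
    ((Multiset.toFinset_card_le _).trans (card_roots' p))
  rw [Multiset.mem_toFinset, mem_roots hp]
  simpa using (List.mem_filter.1 (List.mem_toFinset.1 hx)).2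

lemma runs_goodPoints_take {p : ℝ[X]} {d : ℕ} (hp : p ≠ 0) (hd : p.natDegree ≤ d) (N : ℕ) :
    Runs (goodPoints (firstCoeffs (d + 1) p) (List.range (N + d)))
      ((N + d) * (3 + 2 * (d + 1))) fun good => ∃ xs : List ℝ,
        good.take N = xs.map (fun x => (x, p.eval x)) ∧ xs.length = N ∧ xs.Nodup ∧
          ∀ x ∈ xs, p.eval x ≠ 0 := by
  classical
  have hnodup : ((List.range (N + d)).map (Nat.cast : ℕ → ℝ)).Nodup :=
    List.nodup_range.map Nat.cast_injective
  have hcount := length_le_length_filter_add_natDegree hp hnodup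
  rw [List.length_map, List.length_range] at hcount
  refine (runs_goodPoints _ _).mono (by simp [length_firstCoeffs]) fun good hgood => ?_
  rw [ofCoeffs_firstCoeffs (Nat.lt_succ_of_le hd)] at hgood
  refine ⟨_, by rw [hgood, ← List.map_take], ?_, (hnodup.filter _).sublist (List.take_sublist _ _),
    fun x hx => by simpa using (List.mem_filter.1 (List.mem_of_mem_take hx)).2⟩
  rw [List.length_take, min_eq_left (by omega)]

/-- The cost of evaluating the coefficients of one member of the family and computing its
subresultants. -/
def memberCost (d m : ℕ) : ℕ :=
  (m + 1) * (1 + 2 * (d + 1)) + ((5 * m + 12) * (2 * m + 1) + 2 * m + 2)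

lemma runs_evalRows {P : ℝ[X][X]} {d : ℕ} (hd : ∀ i, (P.coeff i).natDegree ≤ d) (N : ℕ) (γ : ℝ) :
    Runs (mapList (fun row => evalAt row γ) ((firstCoeffs N P).map (firstCoeffs (d + 1))))
      (N * (1 + 2 * (d + 1))) (· = firstCoeffs N (P.map (evalRingHom γ))) := by
  refine (runs_mapList (T := 1 + 2 * (d + 1)) (fun row => (ofCoeffs row).eval γ) _
    fun row hrow => ?_).mono (by rw [List.length_map, length_firstCoeffs]) fun p hp => ?_
  · obtain ⟨p, -, rfl⟩ := List.mem_map.1 hrow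
    exact (runs_evalAt _ γ).trans_le (by rw [length_firstCoeffs])
  · rw [hp, List.map_map, ← map_eval_firstCoeffs]
    refine List.map_congr_left fun p hp => ?_
    obtain ⟨i, -, rfl⟩ := List.mem_map.1 hp
    rw [Function.comp_apply, ofCoeffs_firstCoeffs (Nat.lt_succ_of_le (hd i))]

lemma runs_sRes_member {P : ℝ[X][X]} {d : ℕ} (hd : ∀ i, (P.coeff i).natDegree ≤ d) {γ : ℝ}
    (hγ : P.leadingCoeff.eval γ ≠ 0) :
    Runs (mapList (fun row => evalAt row γ)
        ((firstCoeffs (P.natDegree + 1) P).map (firstCoeffs (d + 1))) >>= allSRes)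
      (memberCost d P.natDegree)
      (· = (List.range P.natDegree).map fun k => sRes k (P.map (evalRingHom γ))) := by
  have hdeg := natDegree_map_of_leadingCoeff_ne_zero (evalRingHom γ) hγ
  have hcoeffs : ofCoeffs (firstCoeffs (P.natDegree + 1) (P.map (evalRingHom γ)))
      = P.map (evalRingHom γ) := ofCoeffs_firstCoeffs (by omega)
  refine Runs.bind (runs_evalRows hd _ γ) fun p hp => ?_
  rw [hp]
  have h := runs_allSRes (length_firstCoeffs (P.natDegree + 1) (P.map (evalRingHom γ)))
    (by rw [hcoeffs, hdeg])
  rwa [hcoeffs] at h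

lemma runs_quotients {v : ℝ} (hv : v ≠ 0) (l : List ℝ) (n : ℕ) :
    Runs (do
      let r ← divL l.reverse v
      let z ← zeros (n - r.length)
      pure (r ++ z)) (l.length + 1)
      (· = (l.reverse.map fun a => a / v) ++ List.replicate (n - l.length) 0) :=
  (Runs.bind (runs_divL hv _) fun r hr => Runs.bind (T₂ := 0) (runs_zeros _) fun z hz =>
    Runs.pure (by simp [hr, hz])).trans_le (by simp)

lemma map_reverse_append_replicate {m n : ℕ} (hmn : m ≤ n) (F : ℕ → ℝ) (v : ℝ) :
    (((List.range m).map F).reverse.map fun a => a / v) ++ List.replicate (n - m) 0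
      = (List.range n).map fun k => if k < m then F (m - (k + 1)) / v else 0 := by
  refine List.ext_getElem (by simp [hmn]) fun k _ _ => ?_
  rcases lt_or_ge k m with hk | hk
  · simp [hk, Nat.sub_sub, add_comm 1 k]
  · simp [List.getElem_append, hk.not_gt]

/-- A bound for the number of steps of FastRR, where `m` is the degree of the general member of the
family. The summands belong to the steps of the program in their order. -/
def fastRRCost (n d m : ℕ) : ℕ :=
  (n + 1) * (d + 1) + ((2 * d * n + d) * (3 + 2 * (d + 1)) + (2 * d * n * memberCost d m
    + (2 * d * n * (m + 1) + (2 * d * n * (1 + 2 * (2 * d * n))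
    + n * (2 * d * n + combineCost (Nat.clog 2 (2 * d * n)))))))

lemma runs_mapList_quotients {m n : ℕ} (hmn : m ≤ n) {xs : List ℝ} {v : ℝ → ℝ}
    (hv : ∀ x ∈ xs, v x ≠ 0) (F : ℝ → ℕ → ℝ) :
    Runs (mapList (fun a : ℝ × List ℝ => do
        let r ← divL a.2.reverse a.1
        let z ← zeros (n - r.length)
        pure (r ++ z)) (xs.map fun x => (v x, (List.range m).map (F x))))
      (xs.length * (m + 1))
      (· = xs.map fun x =>
        (List.range n).map fun k => if k < m then F x (m - (k + 1)) / v x else 0) := by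
  refine (runs_mapList (T := m + 1) (fun a => (a.2.reverse.map fun b => b / a.1)
    ++ List.replicate (n - a.2.length) 0) _ fun a ha => ?_).mono (by simp) fun values h => ?_
  · obtain ⟨x, hx, rfl⟩ := List.mem_map.1 ha
    exact (runs_quotients (hv x hx) _ n).trans_le (by simp)
  · rw [h, List.map_map]
    refine List.map_congr_left fun x _ => ?_
    rw [← map_reverse_append_replicate hmn, Function.comp_apply, List.length_map,
      List.length_range]

lemma runs_interpolate_columns {xs : List ℝ} (hxs : xs.Nodup) {n : ℕ} {Q : ℕ → ℝ[X]}
    (hQ : ∀ k < n, (Q k).degree < xs.length) :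
    Runs (mapList (fun k => interpolate xs (xs.map (nodeWeight xs))
        ((xs.map fun x => (List.range n).map fun k => (Q k).eval x).filterMap
          fun row => row[k]?)) (List.range n))
      (n * (xs.length + combineCost (Nat.clog 2 xs.length)))
      fun out => out.map ofCoeffs = (List.range n).map Q := by
  refine (runs_mapList_forall₂ (T := xs.length + combineCost (Nat.clog 2 xs.length))
    (Q := fun k r => ofCoeffs r = Q k) _ fun k hk => ?_).mono (by simp) fun out hout => ?_
  · have hk' := List.mem_range.1 hk
    have hcolumn : ((xs.map fun x => (List.range n).map fun k => (Q k).eval x).filterMap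
        fun row => row[k]?) = xs.map fun x => (Q k).eval x := by
      simp [List.filterMap_map, hk']
    rw [hcolumn]
    exact runs_interpolate hxs (hQ k hk')
  · rw [← List.forall₂_eq_eq_eq, List.forall₂_map_left_iff, List.forall₂_map_right_iff]
    exact hout.flip

theorem runs_fastRR {P : ℝ[X][X]} {n d : ℕ} (hd₀ : 1 ≤ d) (hP : P ≠ 0)
    (hPn : P.natDegree ≤ n) (hd : ∀ i, (P.coeff i).natDegree ≤ d) :
    Runs (fastRR n d fun k j => (P.coeff k).coeff j) (fastRRCost n d P.natDegree) fun D =>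
      D.points.length = 2 * d * n ∧ D.points.Nodup ∧
      (∀ γ ∈ D.points, P.leadingCoeff.eval γ ≠ 0) ∧
      D.sres = D.points.map (fun γ =>
        (List.range P.natDegree).map fun k => sRes k (P.map (evalRingHom γ))) ∧
      ∃ q : Fin n → ℝ[X], D.output.map ofCoeffs = List.ofFn q ∧ ∀ k : Fin n,
        (q k).natDegree ≤ 2 * d * n ∧ ∀ γ : ℝ, P.leadingCoeff.eval γ ≠ 0 →
          (((q k).eval γ : ℝ) : ℂ) = sDisc (k + 1) (P.map (evalRingHom γ)) := by
  choose Q hQdeg hQ using exists_sDisc_polynomial hd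
  have hQdeg' : ∀ k < n, (Q k).natDegree < 2 * d * n := fun k hk =>
    (hQdeg k).trans_lt (by nlinarith)
  rw [fastRR, ofFn_ofFn_coeff]
  refine Runs.bind (runs_trimRows hP hPn hd) fun rows hrows => ?_
  have hlast : ((firstCoeffs (P.natDegree + 1) P).map (firstCoeffs (d + 1))).getLast?
      = some (firstCoeffs (d + 1) P.leadingCoeff) := by simp [firstCoeffs_succ P.natDegree]
  rw [hrows, hlast]
  refine Runs.bind (runs_goodPoints_take (leadingCoeff_ne_zero.2 hP) (hd _) (2 * d * n))
    fun good hgood => ?_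
  obtain ⟨xs, htake, hlen, hnodup, hxs⟩ := hgood
  have hfst : (good.take (2 * d * n)).map Prod.fst = xs := by simp [htake, Function.comp_def]
  have hsnd : (good.take (2 * d * n)).map Prod.snd = xs.map fun x => P.leadingCoeff.eval x := by
    simp [htake]
  have hdeg : ∀ k < n, (Q k).degree < xs.length := fun k hk =>
    degree_le_natDegree.trans_lt (by exact_mod_cast hlen ▸ hQdeg' k hk)
  dsimp only
  rw [hfst, hsnd, ← hlen]
  refine Runs.bind (runs_mapList (fun x => (List.range P.natDegree).map fun k =>
    sRes k (P.map (evalRingHom x))) xs fun x hx => runs_sRes_member hd (hxs x hx))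
      fun sres hsres => ?_
  rw [hsres, List.zip_map']
  refine Runs.bind (runs_mapList_quotients hPn hxs _) fun values hvalues => ?_
  have hvalues' : values = xs.map fun x => (List.range n).map fun k => (Q k).eval x :=
    hvalues.trans (List.map_congr_left fun x hx =>
      List.map_congr_left fun k _ => ((hQ k x (hxs x hx)).1).symm)
  refine Runs.bind (runs_nodeWeights [] xs hnodup) fun weights hweights => ?_
  rw [hvalues', hweights, List.nil_append]
  refine Runs.bind (T₂ := 0) (runs_interpolate_columns hnodup hdeg) fun out hout => Runs.pure ?_
  refine ⟨rfl, hnodup, hxs, rfl, fun k => Q k, ?_, fun k => ⟨hlen ▸ (hQdeg' k k.2).le, fun γ hγ =>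
    (hQ k γ hγ).2⟩⟩
  rw [hout]
  exact List.ext_getElem (by simp) fun _ _ _ => by simp

lemma memberCost_le {n d m : ℕ} (hn : 1 ≤ n) (hd : 1 ≤ d) (hmn : m ≤ n) :
    memberCost d m ≤ 55 * (n * (d + n)) := by
  have eval_le : (m + 1) * (1 + 2 * (d + 1)) ≤ 2 * n * (5 * d) :=
    Nat.mul_le_mul (by omega) (by omega)
  have euclid_le : (5 * m + 12) * (2 * m + 1) ≤ 17 * n * (3 * n) :=
    Nat.mul_le_mul (by omega) (by omega)
  rw [memberCost]
  nlinarith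

lemma combineCost_clog_le {n d : ℕ} (hn : 1 ≤ n) (hd : 1 ≤ d) :
    combineCost (Nat.clog 2 (2 * d * n)) ≤ 3513 * (d * n * (d + n)) := by
  have hdn : 1 ≤ d * n := Nat.mul_pos hd hn
  refine (Nat.pow_le_pow_iff_left two_ne_zero).1 ?_
  calc combineCost (Nat.clog 2 (2 * d * n)) ^ 2 ≤ 771282 * (2 * (2 * d * n)) ^ 3 :=
        combineCost_clog_sq_le (by nlinarith)
    _ = 771282 * 16 * (d * n) ^ 2 * (4 * d * n) := by ring
    _ ≤ 771282 * 16 * (d * n) ^ 2 * (d + n) ^ 2 := Nat.mul_le_mul_left _ (four_mul_le_sq_add d n)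
    _ ≤ (3513 * (d * n * (d + n))) ^ 2 := by
      rw [mul_assoc, ← mul_pow, mul_pow 3513]
      exact Nat.mul_le_mul_right _ (by norm_num)

theorem fastRRCost_le {n d m : ℕ} (hn : 1 ≤ n) (hd : 1 ≤ d) (hmn : m ≤ n) :
    fastRRCost n d m ≤ 3664 * (d * n ^ 2 * (d + n)) := by
  have hdn : d * n ≤ d * n * (n * (d + n)) := Nat.le_mul_of_pos_right _ (by positivity)
  have hddn : d * n * d ≤ d * n * (n * (d + n)) := by gcongr; nlinarith
  have hdnn : d * n * n ≤ d * n * (n * (d + n)) := by gcongr; nlinarith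
  have hdndn : d * n * (d * n) ≤ d * n * (n * (d + n)) :=
    Nat.mul_le_mul_left _ (by nlinarith)
  have trim : (n + 1) * (d + 1) ≤ 2 * n * (2 * d) := Nat.mul_le_mul (by omega) (by omega)
  have points : (2 * d * n + d) * (3 + 2 * (d + 1)) ≤ 3 * (d * n) * (7 * d) :=
    Nat.mul_le_mul (by nlinarith) (by omega)
  have members : 2 * d * n * memberCost d m ≤ 2 * d * n * (55 * (n * (d + n))) :=
    Nat.mul_le_mul_left _ (memberCost_le hn hd hmn)
  have quotients : 2 * d * n * (m + 1) ≤ 2 * d * n * (2 * n) :=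
    Nat.mul_le_mul_left _ (by omega)
  have interpolation : n * (2 * d * n + combineCost (Nat.clog 2 (2 * d * n)))
      ≤ n * (2 * d * n + 3513 * (d * n * (d + n))) :=
    Nat.mul_le_mul_left _ (Nat.add_le_add_left (combineCost_clog_le hn hd) _)
  rw [fastRRCost]
  nlinarith

end Prog

theorem mainTheorem5_general :
    ∃ A : ℕ, ∀ (n d : ℕ), 1 ≤ n → 1 ≤ d →
      ∀ (c : Fin (n + 1) → ℝ[X]) (m : Fin (n + 1)),
        (∀ k, (c k).natDegree ≤ d) → c m ≠ 0 → (∀ k, m < k → c k = 0) →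
        ∃ (D : FastRRData ℝ) (t : ℕ),
          (fastRR n d fun k j => (c k).coeff (j : ℕ)).run = some (D, t) ∧
          t ≤ A * (d * n ^ 2 * (d + n)) ∧
          D.points.length = 2 * d * n ∧ D.points.Nodup ∧
          (∀ γ ∈ D.points, (c m).eval γ ≠ 0) ∧
          D.sres = D.points.map
            (fun γ => (List.range (m : ℕ)).map fun k => sRes k (member c γ)) ∧
          ∃ q : Fin n → ℝ[X],
            D.output.map ofCoeffs = List.ofFn q ∧
            ∀ k : Fin n,
              (q k).natDegree ≤ 2 * d * n ∧
              ∀ γ : ℝ, (c m).eval γ ≠ 0 →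
                (((q k).eval γ : ℝ) : ℂ) = sDisc (k + 1) (member c γ) := by
  refine ⟨3664, fun n d hn hd₀ c m hd hcm hc => ?_⟩
  have hdeg := natDegree_familyPoly hcm hc
  have hlead : (familyPoly c).leadingCoeff = c m := by
    rw [leadingCoeff, hdeg, coeff_familyPoly_coe]
  have hP : familyPoly c ≠ 0 := leadingCoeff_ne_zero.1 (hlead ▸ hcm)
  have hmn : (m : ℕ) ≤ n := Nat.lt_succ_iff.1 m.is_lt
  have h := Prog.runs_fastRR hd₀ hP (hdeg.trans_le hmn) (natDegree_coeff_familyPoly_le hd)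
  simp only [coeff_familyPoly_coe, map_evalRingHom_familyPoly, hdeg, hlead] at h
  exact h.trans_le (Prog.fastRRCost_le hn hd₀ hmn)

theorem mainTheorem5 :
    ∀ κ : ℕ, ∃ A : ℕ, ∀ (n d : ℕ), 1 ≤ d → d ≤ κ * n →
      ∀ (c : Fin (n + 1) → ℝ[X]) (m : Fin (n + 1)),
        (∀ k, (c k).natDegree ≤ d) → c m ≠ 0 → (∀ k, m < k → c k = 0) →
        ∃ (D : FastRRData ℝ) (t : ℕ),
          (fastRR n d fun k j => (c k).coeff (j : ℕ)).run = some (D, t) ∧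
          t ≤ A * n ^ 4 ∧
          D.points.length = 2 * d * n ∧ D.points.Nodup ∧
          (∀ γ ∈ D.points, (c m).eval γ ≠ 0) ∧
          D.sres = D.points.map
            (fun γ => (List.range (m : ℕ)).map fun k => sRes k (member c γ)) ∧
          ∃ q : Fin n → ℝ[X],
            D.output.map ofCoeffs = List.ofFn q ∧
            ∀ k : Fin n,
              (q k).natDegree ≤ 2 * d * n ∧
              ∀ γ : ℝ, (c m).eval γ ≠ 0 →
                (((q k).eval γ : ℝ) : ℂ) = sDisc (k + 1) (member c γ) := by
  intro κ
  obtain ⟨A, hA⟩ := mainTheorem5_general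
  refine ⟨A * (κ * (κ + 1)), fun n d hd₀ hdn c m hd hcm hc => ?_⟩
  have hn : 1 ≤ n := Nat.one_le_iff_ne_zero.2 fun h => by simp [h] at hdn; omega
  obtain ⟨D, t, hrun, ht, h⟩ := hA n d hn hd₀ c m hd hcm hc
  refine ⟨D, t, hrun, ht.trans ?_, h⟩
  calc A * (d * n ^ 2 * (d + n)) ≤ A * (κ * n * n ^ 2 * (κ * n + n)) := by gcongr
    _ = A * (κ * (κ + 1)) * n ^ 4 := by ring
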